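/- **Proposition 6.2.** Let $\mathbb{B}^2\subset\mathbb{R}^2$ be the open unit disk, let $g\in W^{1,q}_{loc}(\mathbb{B}^2)$ for every $q\in[1,2)$, and let $\mu\in W^{1,2}(\mathbb{B}^2)\cap L^\infty_{loc}(\mathbb{B}^2)$ be a critical point of $$F(\mu)=\int |\nabla\mu|^2+\int(\mu^2-2\mu)\,g\qquad\text{subject to }\mu\ge 0,$$ that is, $\mu\ge0$ a.e. in $\mathbb{B}^2$, and $$\frac{d}{d\varepsilon}\Big|_{\varepsilon=0^+}\left(\int_K|\nabla(\mu+\varepsilon\varphi)|^2+\int_K\big((\mu+\varepsilon\varphi)^2-2(\mu+\varepsilon\varphi)\big)g\right)\ \ge\ 0$$ for every compact set $K\subset\mathbb{B}^2$ and every $\varphi\in W^{1,2}(\mathbb{B}^2)\cap L^\infty(\mathbb{B}^2)$ which vanishes a.e. outside $K$ and satisfies $\mu+\varepsilon\varphi\ge0$ a.e. in $\mathbb{B}^2$ for all sufficiently small $\varepsilon\ge0$. Then $\mu\in W^{2,2}_{loc}(\mathbb{B}^2)$. -/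

import Mathlib

open MeasureTheory Set
open scoped ENNReal ContDiff

noncomputable section

/-- `g` is the weak partial derivative `∂ᵢ f` on the open set `U ⊆ ℝᵈ`: both functions are locally
integrable on `U` and `∫_U f ∂ᵢψ = - ∫_U g ψ` for every test function `ψ ∈ C_c^∞(U)`. -/
def HasWeakPartial {d : ℕ} (U : Set (EuclideanSpace ℝ (Fin d))) (i : Fin d)
    (f g : EuclideanSpace ℝ (Fin d) → ℝ) : Prop :=
  LocallyIntegrableOn f U ∧ LocallyIntegrableOn g U ∧
    ∀ ψ : EuclideanSpace ℝ (Fin d) → ℝ, ContDiff ℝ ∞ ψ → HasCompactSupport ψ → tsupport ψ ⊆ U →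
      ∫ x in U, f x * fderiv ℝ ψ x (EuclideanSpace.single i 1) = - ∫ x in U, g x * ψ x

/-- `f ∈ L^p_loc(U)`: `f ∈ L^p(K)` for every compact `K ⊆ U`. -/
def MemLpLoc {d : ℕ} (p : ℝ≥0∞) (U : Set (EuclideanSpace ℝ (Fin d)))
    (f : EuclideanSpace ℝ (Fin d) → ℝ) : Prop :=
  ∀ K : Set (EuclideanSpace ℝ (Fin d)), IsCompact K → K ⊆ U → MemLp f p (volume.restrict K)

/-- `f ∈ W^{k,p}(U)`, by recursion on `k`: `f ∈ L^p(U)` and, for `k ≥ 1`, all first weak partial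
derivatives exist on `U` and belong to `W^{k-1,p}(U)`. -/
def MemSobolev {d : ℕ} (k : ℕ) (p : ℝ≥0∞) (U : Set (EuclideanSpace ℝ (Fin d)))
    (f : EuclideanSpace ℝ (Fin d) → ℝ) : Prop :=
  match k with
  | 0 => MemLp f p (volume.restrict U)
  | k + 1 => MemLp f p (volume.restrict U) ∧
      ∀ i : Fin d, ∃ g : EuclideanSpace ℝ (Fin d) → ℝ,
        HasWeakPartial U i f g ∧ MemSobolev k p U g

/-- `f ∈ W^{k,p}_loc(U)`, by recursion on `k`: `f ∈ L^p_loc(U)` and, for `k ≥ 1`, all first weak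
partial derivatives exist on `U` and belong to `W^{k-1,p}_loc(U)`. -/
def MemSobolevLoc {d : ℕ} (k : ℕ) (p : ℝ≥0∞) (U : Set (EuclideanSpace ℝ (Fin d)))
    (f : EuclideanSpace ℝ (Fin d) → ℝ) : Prop :=
  match k with
  | 0 => MemLpLoc p U f
  | k + 1 => MemLpLoc p U f ∧
      ∀ i : Fin d, ∃ g : EuclideanSpace ℝ (Fin d) → ℝ,
        HasWeakPartial U i f g ∧ MemSobolevLoc k p U g

open Classical in
/-- The weak partial derivative `∂ᵢ f` on `U` (unique up to a null set; a version is chosen);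
`0` if `f` has none. -/
def weakPartial {d : ℕ} (U : Set (EuclideanSpace ℝ (Fin d))) (i : Fin d)
    (f : EuclideanSpace ℝ (Fin d) → ℝ) : EuclideanSpace ℝ (Fin d) → ℝ :=
  if h : ∃ g, HasWeakPartial U i f g then h.choose else 0

/-- The energy `F_K(u) = ∫_K |∇u|² + ∫_K (u² - 2u) g` over the part `K` of the domain `U`. -/
def obstacleEnergy {d : ℕ} (U K : Set (EuclideanSpace ℝ (Fin d)))
    (g u : EuclideanSpace ℝ (Fin d) → ℝ) : ℝ :=
  (∫ x in K, ∑ i, (weakPartial U i u x) ^ 2) + ∫ x in K, ((u x) ^ 2 - 2 * u x) * g x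

/-- `u` is a critical point of `F(u) = ∫_U |∇u|² + ∫_U (u² - 2u) g` subject to `u ≥ 0`:
`u ≥ 0` a.e., and `d/dε|_{ε = 0⁺} F(u + ε φ) ≥ 0` for every bounded `φ ∈ W^{1,2}(U)` that vanishes
a.e. outside some compact `K ⊆ U` and is admissible, i.e. `u + ε φ ≥ 0` a.e. in `U` for all small
`ε ≥ 0`. As `u + ε φ` differs from `u` on `K` only, and `g` and `u` are controlled only locally,
the derivative is that of the energy over `K`. -/
def IsObstacleCriticalPoint {d : ℕ} (U : Set (EuclideanSpace ℝ (Fin d)))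
    (g u : EuclideanSpace ℝ (Fin d) → ℝ) : Prop :=
  (∀ᵐ x ∂(volume.restrict U), 0 ≤ u x) ∧
  ∀ (K : Set (EuclideanSpace ℝ (Fin d))) (φ : EuclideanSpace ℝ (Fin d) → ℝ),
    IsCompact K → K ⊆ U →
    MemSobolev 1 2 U φ → MemLp φ ∞ (volume.restrict U) →
    (∀ᵐ x ∂(volume.restrict (U \ K)), φ x = 0) →
    (∃ ε₀ > (0 : ℝ), ∀ ε ∈ Icc 0 ε₀, ∀ᵐ x ∂(volume.restrict U), 0 ≤ u x + ε * φ x) →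
    ∃ D : ℝ, 0 ≤ D ∧
      HasDerivWithinAt (fun ε : ℝ => obstacleEnergy U K g (fun x => u x + ε * φ x)) D (Ici 0) 0

end

/-! The obstacle problem has a bounded measure of contact force: formally `-Δμ + (μ - 1) g ≥ 0`,
with equality where `μ > 0`, while on `{μ = 0}` the Laplacian of `μ` should vanish. Hence `|Δμ| ≤
|(μ - 1) g|`, and the right side is in `L²_loc`: `μ` is locally bounded, and in the plane
`W^{1,1}_loc ⊆ L²_loc`, so `g ∈ L²_loc` (`memLpLoc_two_of_hasWeakPartial`). Interior `L²` regularity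
for the Laplacian then gives `μ ∈ W^{2,2}_loc`.

The bound on `Δμ` is proved weakly, against test functions `ζ ≥ 0`. The variation `ζ` is always
admissible and gives one side. For the other side the variation is `-ζ T_δ(μ)`, where `T_δ` is a
smooth approximation of `1_{t ≠ 0}` with `T_δ(t) ≤ t / δ` for `t ≥ 0`, so that `μ - ε ζ T_δ(μ) ≥ 0`
for small `ε`. The term `-ζ T_δ'(μ) |∇μ|²` has a favourable sign and is dropped; the rest is the
weak Laplacian of `P_δ(μ)`, where `P_δ' = T_δ`. Since `P_δ → id` uniformly, `δ → 0` yields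
`IsObstacleCriticalPoint.abs_integral_mul_coordLaplacian_le`.

For the regularity, `w = χ μ` with a cutoff `χ` satisfies a bound of the same kind on the whole
space, with an `L²` majorant `H` (`abs_integral_cutoff_mul_coordLaplacian_le`). Testing with a
translated mollifier turns it into the pointwise bound `|Δ w_n| ≤ H_n` for the mollified functions.
The identity `∑ᵢⱼ ∫ (∂ᵢ∂ⱼ w_n)² = ∫ (Δ w_n)²` bounds all second derivatives in `L²`, and a weak
limit is the second weak derivative (`exists_memLp_two_second_derivative`). The local derivatives
are glued along an exhaustion of the disk. -/

open Filter Topology ContinuousLinearMap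
open scoped Convolution

/-! ### Classical partial derivatives and convolution -/

/-- The classical partial derivative `∂ᵢ ψ`. -/
noncomputable def partialDeriv {d : ℕ} (i : Fin d) (ψ : EuclideanSpace ℝ (Fin d) → ℝ)
    (x : EuclideanSpace ℝ (Fin d)) : ℝ :=
  fderiv ℝ ψ x (EuclideanSpace.single i 1)

/-- The convolution `ψ ⋆ f` of real functions on `ℝᵈ`. -/
noncomputable def conv {d : ℕ} (ψ f : EuclideanSpace ℝ (Fin d) → ℝ) :
    EuclideanSpace ℝ (Fin d) → ℝ :=
  ψ ⋆[lsmul ℝ ℝ, volume] f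

section PartialDeriv

variable {d : ℕ} {i : Fin d} {ψ χ : EuclideanSpace ℝ (Fin d) → ℝ}

theorem ContDiff.partialDeriv (h : ContDiff ℝ ∞ ψ) : ContDiff ℝ ∞ (partialDeriv i ψ) :=
  (h.fderiv_right (m := ∞) (by simp)).clm_apply contDiff_const

theorem support_partialDeriv_subset : Function.support (partialDeriv i ψ) ⊆ tsupport ψ := by
  intro x hx
  refine support_fderiv_subset ℝ (f := ψ) ?_
  intro h
  exact hx (by simp [partialDeriv, h])

theorem tsupport_partialDeriv_subset : tsupport (partialDeriv i ψ) ⊆ tsupport ψ :=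
  closure_minimal support_partialDeriv_subset (isClosed_tsupport ψ)

theorem HasCompactSupport.partialDeriv (h : HasCompactSupport ψ) :
    HasCompactSupport (partialDeriv i ψ) :=
  h.mono' support_partialDeriv_subset

theorem partialDeriv_mul (hψ : ContDiff ℝ ∞ ψ) (hχ : ContDiff ℝ ∞ χ) (x) :
    partialDeriv i (fun y => ψ y * χ y) x
      = partialDeriv i ψ x * χ x + ψ x * partialDeriv i χ x := by
  have h1 : DifferentiableAt ℝ ψ x := (hψ.differentiable (by simp)) x
  have h2 : DifferentiableAt ℝ χ x := (hχ.differentiable (by simp)) x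
  simp only [partialDeriv]
  rw [fderiv_fun_mul h1 h2]
  simp
  ring

theorem partialDeriv_comm (hψ : ContDiff ℝ ∞ ψ) (i j : Fin d) (x) :
    partialDeriv i (partialDeriv j ψ) x = partialDeriv j (partialDeriv i ψ) x := by
  have hd : DifferentiableAt ℝ (fderiv ℝ ψ) x :=
    (hψ.fderiv_right (m := ∞) (by simp)).differentiable (by simp) x
  have key : ∀ a b : Fin d, partialDeriv a (partialDeriv b ψ) x
      = fderiv ℝ (fderiv ℝ ψ) x (EuclideanSpace.single a 1) (EuclideanSpace.single b 1) := by
    intro a b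
    change fderiv ℝ (fun y => fderiv ℝ ψ y (EuclideanSpace.single b 1)) x _ = _
    rw [fderiv_clm_apply hd (differentiableAt_const _)]
    simp
  rw [key, key]
  exact (hψ.contDiffAt.isSymmSndFDerivAt (by simp; exact WithTop.coe_le_coe.2 le_top)) _ _

theorem integral_partialDeriv_mul (hψ : ContDiff ℝ ∞ ψ) (hχ : ContDiff ℝ ∞ χ)
    (hc : HasCompactSupport ψ) :
    ∫ x, partialDeriv i ψ x * χ x = - ∫ x, ψ x * partialDeriv i χ x := by
  have := integral_mul_fderiv_eq_neg_fderiv_mul_of_integrable (μ := volume)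
    (f := ψ) (g := χ) (v := EuclideanSpace.single i (1 : ℝ))
    ((hψ.partialDeriv (i := i)).continuous.mul hχ.continuous |>.integrable_of_hasCompactSupport
      (hc.partialDeriv.mul_right))
    (hψ.continuous.mul (hχ.partialDeriv (i := i)).continuous |>.integrable_of_hasCompactSupport
      (hc.mul_right))
    ((hψ.continuous.mul hχ.continuous).integrable_of_hasCompactSupport hc.mul_right)
    (fun x _ => hψ.differentiable (by simp) x) (fun x _ => hχ.differentiable (by simp) x)
  simp only [partialDeriv]
  rw [this, neg_neg]

end PartialDeriv

section Conv

variable {d : ℕ} {ψ f g : EuclideanSpace ℝ (Fin d) → ℝ}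

theorem conv_apply (x) : conv ψ f x = ∫ t, ψ (x - t) * f t := by
  rw [conv, convolution_lsmul_swap]; rfl

theorem integrable_conv_integrand (hψ : Continuous ψ) (hc : HasCompactSupport ψ)
    (hf : LocallyIntegrable f) (x) : Integrable (fun t => ψ (x - t) * f t) := by
  have hc' : HasCompactSupport (fun t => ψ (x - t)) :=
    hc.comp_homeomorph (Homeomorph.subLeft x)
  exact hf.integrable_smul_left_of_hasCompactSupport (hψ.comp (by fun_prop)) hc'

theorem contDiff_conv (hψ : ContDiff ℝ ∞ ψ) (hc : HasCompactSupport ψ)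
    (hf : LocallyIntegrable f) : ContDiff ℝ ∞ (conv ψ f) :=
  hc.contDiff_convolution_left (n := ⊤) _ hψ hf

theorem hasCompactSupport_conv (hc : HasCompactSupport ψ) (hf : HasCompactSupport f) :
    HasCompactSupport (conv ψ f) :=
  hc.convolution _ hf

theorem partialDeriv_conv (hψ : ContDiff ℝ ∞ ψ) (hc : HasCompactSupport ψ)
    (hf : LocallyIntegrable f) (i : Fin d) (x) :
    partialDeriv i (conv ψ f) x = conv (partialDeriv i ψ) f x := by
  have h := (hc.hasFDerivAt_convolution_left (lsmul ℝ ℝ) (hψ.of_le (by simp)) hf x)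
  simp only [partialDeriv, conv]
  rw [h.fderiv]
  have h1 : Continuous (fderiv ℝ ψ) := hψ.continuous_fderiv (by simp)
  have := (hc.fderiv ℝ).convolutionExists_left
    ((lsmul ℝ ℝ : ℝ →L[ℝ] ℝ →L[ℝ] ℝ).precompL (EuclideanSpace ℝ (Fin d)) :) h1 hf x
  simp_rw [convolution_def, ContinuousLinearMap.integral_apply this]
  rfl

end Conv

/-! ### Mollification: contraction and convergence -/

section Mollify

variable {d : ℕ}

/-- A bump function supported in the ball of radius `1 / (n + 1)`. -/
noncomputable def mollifierBump (d n : ℕ) : ContDiffBump (0 : EuclideanSpace ℝ (Fin d)) where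
  rIn := 1 / (2 * ((n : ℝ) + 1))
  rOut := 1 / ((n : ℝ) + 1)
  rIn_pos := by positivity
  rIn_lt_rOut := by
    apply one_div_lt_one_div_of_lt <;> nlinarith [Nat.cast_nonneg (α := ℝ) n]

/-- The normalised bump function with support of radius `1 / (n + 1)`. -/
noncomputable def mollifier (d n : ℕ) : EuclideanSpace ℝ (Fin d) → ℝ :=
  (mollifierBump d n).normed volume

/-- The convolution of `f` with `mollifier d n`. -/
noncomputable def mollify (n : ℕ) (f : EuclideanSpace ℝ (Fin d) → ℝ) :
    EuclideanSpace ℝ (Fin d) → ℝ :=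
  conv (mollifier d n) f

variable {n : ℕ} {f g : EuclideanSpace ℝ (Fin d) → ℝ}

theorem contDiff_mollifier : ContDiff ℝ ∞ (mollifier d n) := (mollifierBump d n).contDiff_normed

theorem hasCompactSupport_mollifier : HasCompactSupport (mollifier d n) :=
  (mollifierBump d n).hasCompactSupport_normed

theorem mollifier_nonneg (x) : 0 ≤ mollifier d n x := (mollifierBump d n).nonneg_normed x

theorem integral_mollifier : ∫ x, mollifier d n x = 1 := (mollifierBump d n).integral_normed

theorem integrable_mollifier : Integrable (mollifier d n) :=
  contDiff_mollifier.continuous.integrable_of_hasCompactSupport hasCompactSupport_mollifier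

theorem integral_mollifier_sub (x) : ∫ t, mollifier d n (x - t) = 1 := by
  rw [integral_sub_left_eq_self (mollifier d n) volume x, integral_mollifier]

theorem mollifierBump_rOut_le_one : (mollifierBump d n).rOut ≤ 1 := by
  change 1 / ((n : ℝ) + 1) ≤ 1
  rw [div_le_one (by positivity)]
  linarith [Nat.cast_nonneg (α := ℝ) n]

theorem tendsto_mollifierBump_rOut :
    Tendsto (fun n => (mollifierBump d n).rOut) atTop (𝓝 0) :=
  tendsto_one_div_add_atTop_nhds_zero_nat

theorem contDiff_mollify (hf : LocallyIntegrable f) : ContDiff ℝ ∞ (mollify n f) :=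
  contDiff_conv contDiff_mollifier hasCompactSupport_mollifier hf

theorem hasCompactSupport_mollify (hf : HasCompactSupport f) : HasCompactSupport (mollify n f) :=
  hasCompactSupport_conv hasCompactSupport_mollifier hf

theorem ae_tendsto_mollify (hf : LocallyIntegrable f) :
    ∀ᵐ x, Tendsto (fun n => mollify n f x) atTop (𝓝 (f x)) := by
  -- Lebesgue differentiation needs the ratio of outer to inner radius bounded; for these bumps it
  -- is exactly 2.
  refine ContDiffBump.ae_convolution_tendsto_right_of_locallyIntegrable (K := 2)
    tendsto_mollifierBump_rOut (Eventually.of_forall fun n => ?_) hf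
  change 1 / ((n : ℝ) + 1) ≤ 2 * (1 / (2 * ((n : ℝ) + 1)))
  apply le_of_eq
  field_simp

theorem integrable_mollify (hf : Integrable f) : Integrable (mollify n f) :=
  integrable_mollifier.integrable_convolution _ hf

theorem abs_mollify_le (x) : |mollify n f x| ≤ mollify n (fun t => |f t|) x := by
  rw [mollify, mollify, conv_apply, conv_apply]
  refine (abs_integral_le_integral_abs).trans_eq ?_
  simp_rw [abs_mul, abs_of_nonneg (mollifier_nonneg _)]

theorem integral_mollify (hf : Integrable f) : ∫ x, mollify n f x = ∫ x, f x := by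
  rw [mollify, conv, integral_convolution _ integrable_mollifier hf, integral_mollifier]
  simp

theorem integral_abs_mollify_le (hf : Integrable f) :
    ∫ x, |mollify n f x| ≤ ∫ x, |f x| := by
  rw [← integral_mollify (n := n) hf.abs]
  exact integral_mono (integrable_mollify hf).abs (integrable_mollify hf.abs) abs_mollify_le

/-- Jensen's inequality for the probability density `ρ(x - ·)`, in the form that a variance is
nonnegative: expand `∫ ρ(x - t) (f t - c)²` with `c` the mean. -/
theorem sq_mollify_le (hf : LocallyIntegrable f) (hf2 : LocallyIntegrable fun x => f x ^ 2) (x) :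
    mollify n f x ^ 2 ≤ mollify n (fun t => f t ^ 2) x := by
  set c := mollify n f x with hc
  have i1 := integrable_conv_integrand (contDiff_mollifier (d := d) (n := n)).continuous
    hasCompactSupport_mollifier hf x
  have i2 := integrable_conv_integrand (contDiff_mollifier (d := d) (n := n)).continuous
    hasCompactSupport_mollifier hf2 x
  have i0 : Integrable (fun t => mollifier d n (x - t)) :=
    (integrable_mollifier (d := d) (n := n)).comp_sub_left x
  have h0 : 0 ≤ ∫ t, mollifier d n (x - t) * (f t - c) ^ 2 :=
    integral_nonneg fun t => mul_nonneg (mollifier_nonneg _) (sq_nonneg _)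
  have h1 : ∫ t, mollifier d n (x - t) * (f t - c) ^ 2
      = mollify n (fun t => f t ^ 2) x - 2 * c * c + c ^ 2 := by
    have : ∀ t, mollifier d n (x - t) * (f t - c) ^ 2 = mollifier d n (x - t) * f t ^ 2
        - 2 * c * (mollifier d n (x - t) * f t) + c ^ 2 * mollifier d n (x - t) := by
      intro t; ring
    simp_rw [this]
    have i21 : Integrable (fun t => mollifier d n (x - t) * f t ^ 2
        - 2 * c * (mollifier d n (x - t) * f t)) := i2.sub (i1.const_mul _)
    rw [integral_add i21 (i0.const_mul _),
      integral_sub i2 (i1.const_mul _), integral_const_mul, integral_const_mul,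
      integral_mollifier_sub, mul_one, hc, mollify, mollify, conv_apply, conv_apply]
  nlinarith

theorem integrable_sq_mollify (hf : LocallyIntegrable f) (hf2 : Integrable fun x => f x ^ 2) :
    Integrable (fun x => mollify n f x ^ 2) := by
  refine (integrable_mollify (n := n) hf2).mono'
    ((contDiff_mollify hf).continuous.pow 2).aestronglyMeasurable (ae_of_all _ fun x => ?_)
  rw [Real.norm_of_nonneg (sq_nonneg _)]
  exact sq_mollify_le hf hf2.locallyIntegrable x

theorem integral_sq_mollify_le (hf : LocallyIntegrable f) (hf2 : Integrable fun x => f x ^ 2) :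
    ∫ x, mollify n f x ^ 2 ≤ ∫ x, f x ^ 2 := by
  rw [← integral_mollify (n := n) hf2]
  exact integral_mono (integrable_sq_mollify hf hf2) (integrable_mollify hf2)
    (sq_mollify_le hf hf2.locallyIntegrable)

theorem mollify_sub (hf : LocallyIntegrable f) (hg : LocallyIntegrable g) (x) :
    mollify n (fun t => f t - g t) x = mollify n f x - mollify n g x := by
  simp only [mollify, conv_apply, mul_sub]
  exact integral_sub
    (integrable_conv_integrand contDiff_mollifier.continuous hasCompactSupport_mollifier hf x)
    (integrable_conv_integrand contDiff_mollifier.continuous hasCompactSupport_mollifier hg x)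

/-- Dominated convergence: the mollifier radii are at most 1, so all the differences vanish off the
1-thickening of the support of `f`, and there they are at most twice the bound of `f`. -/
theorem tendsto_integral_abs_mollify_sub_of_continuous (hf : Continuous f)
    (hc : HasCompactSupport f) :
    Tendsto (fun n => ∫ x, |mollify n f x - f x|) atTop (𝓝 0) := by
  obtain ⟨C, hC⟩ := hc.exists_bound_of_continuous hf
  have hK : IsCompact (Metric.cthickening 1 (tsupport f)) := hc.isCompact.cthickening
  have hlim : Tendsto (fun n => ∫ x, |mollify n f x - f x|) atTop
      (𝓝 (∫ _ : EuclideanSpace ℝ (Fin d), (0 : ℝ))) := by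
    refine tendsto_integral_of_dominated_convergence
      ((Metric.cthickening 1 (tsupport f)).indicator fun _ => 2 * C) ?_ ?_ ?_ ?_
    · intro n
      exact (((contDiff_mollify hf.locallyIntegrable).continuous.sub hf).abs).aestronglyMeasurable
    · rw [integrable_indicator_iff hK.measurableSet]
      exact integrableOn_const hK.measure_lt_top.ne
    · intro n
      refine ae_of_all _ fun x => ?_
      rw [Real.norm_eq_abs, abs_abs, ← Real.dist_eq]
      by_cases hx : x ∈ Metric.cthickening 1 (tsupport f)
      · rw [indicator_of_mem hx]
        refine ContDiffBump.dist_normed_convolution_le hf.aestronglyMeasurable fun y _ => ?_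
        rw [Real.dist_eq]
        calc |f y - f x| ≤ |f y| + |f x| := abs_sub _ _
          _ ≤ C + C := add_le_add (hC y) (hC x)
          _ = 2 * C := by ring
      · rw [indicator_of_notMem hx]
        refine ContDiffBump.dist_normed_convolution_le hf.aestronglyMeasurable fun y hy => ?_
        have h0 : ∀ z ∈ Metric.ball x (mollifierBump d n).rOut, f z = 0 := by
          intro z hz
          by_contra h
          apply hx
          refine Metric.mem_cthickening_of_dist_le x z 1 _ (subset_tsupport f h) ?_
          rw [dist_comm]
          exact (Metric.mem_ball.1 hz).le.trans mollifierBump_rOut_le_one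
        rw [h0 y hy, h0 x (Metric.mem_ball_self (mollifierBump d n).rOut_pos), dist_self]
    · refine ae_of_all _ fun x => ?_
      have := ContDiffBump.convolution_tendsto_right_of_continuous (μ := volume)
        (tendsto_mollifierBump_rOut (d := d)) hf x
      have h2 := (this.sub_const (f x)).abs
      rw [sub_self, abs_zero] at h2
      exact h2
  simpa using hlim

/-- Density of continuous compactly supported functions in `L¹`, together with the `L¹` contraction
property of mollification, reduces to the continuous case. -/
theorem tendsto_integral_abs_mollify_sub (hf : Integrable f) :
    Tendsto (fun n => ∫ x, |mollify n f x - f x|) atTop (𝓝 0) := by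
  rw [Metric.tendsto_atTop]
  intro ε hε
  obtain ⟨φ, hφc, hφ, hφcont, hφi⟩ :=
    hf.exists_hasCompactSupport_integral_sub_le (ε := ε / 3) (by positivity)
  obtain ⟨N, hN⟩ := Metric.tendsto_atTop.1
    (tendsto_integral_abs_mollify_sub_of_continuous hφcont hφc) (ε / 3) (by positivity)
  refine ⟨N, fun n hn => ?_⟩
  have h1 := hN n hn
  rw [Real.dist_0_eq_abs] at h1 ⊢
  have h1 := (le_abs_self _).trans_lt h1
  rw [abs_of_nonneg (integral_nonneg fun x => abs_nonneg _)]
  have a1 : Integrable (fun x => |mollify n (fun t => f t - φ t) x|) :=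
    (integrable_mollify (hf.sub hφi)).abs
  have a2 : Integrable (fun x => |mollify n φ x - φ x|) := ((integrable_mollify hφi).sub hφi).abs
  have a3 : Integrable (fun x => |f x - φ x|) := (hf.sub hφi).abs
  have h2 : ∫ x, |mollify n (fun t => f t - φ t) x| ≤ ∫ x, |f x - φ x| :=
    integral_abs_mollify_le (hf.sub hφi)
  have h3 : ∫ x, |f x - φ x| ≤ ε / 3 := hφ
  calc ∫ x, |mollify n f x - f x|
      ≤ ∫ x, (|mollify n (fun t => f t - φ t) x| + |mollify n φ x - φ x| + |f x - φ x|) := by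
        refine integral_mono ((integrable_mollify hf).sub hf).abs ((a1.add a2).add a3) fun x => ?_
        have e : mollify n f x - f x = mollify n (fun t => f t - φ t) x
            + (mollify n φ x - φ x) - (f x - φ x) := by
          rw [mollify_sub hf.locallyIntegrable hφi.locallyIntegrable]; ring
        simp only [e]
        exact (abs_sub _ _).trans (add_le_add_left (abs_add_le _ _) _)
    _ < ε := by
        have a12 : Integrable (fun x => |mollify n (fun t => f t - φ t) x|
            + |mollify n φ x - φ x|) := a1.add a2
        rw [integral_add a12 a3, integral_add a1 a2]
        linarith

end Mollify

/-! ### Smooth cutoffs and local integrability -/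

section Cutoff

variable {d : ℕ} {U K : Set (EuclideanSpace ℝ (Fin d))}

open scoped Manifold in
theorem exists_smooth_cutoff (hU : IsOpen U) (hK : IsCompact K) (hKU : K ⊆ U) :
    ∃ χ : EuclideanSpace ℝ (Fin d) → ℝ, ContDiff ℝ ∞ χ ∧ HasCompactSupport χ ∧ tsupport χ ⊆ U ∧
      (∀ x, χ x ∈ Icc (0 : ℝ) 1) ∧ (∀ x ∈ K, χ x = 1) ∧
      ∀ i, ∀ x ∈ K, partialDeriv i χ x = 0 := by
  obtain ⟨L, hL, hKL, hLU⟩ := exists_compact_between hK hU hKU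
  -- The function is 1 on a neighbourhood of `K`, not merely on `K`; this makes its derivatives
  -- vanish on `K`.
  obtain ⟨f, h1, h0, hf⟩ := exists_contMDiffMap_one_nhds_of_subset_interior
    (n := ⊤) 𝓘(ℝ, EuclideanSpace ℝ (Fin d)) hK.isClosed hKL
  have hs : tsupport f ⊆ L := by
    refine closure_minimal (fun x hx => ?_) hL.isClosed
    by_contra h
    exact hx (h0 x h)
  refine ⟨f, f.contMDiff.contDiff, hL.of_isClosed_subset (isClosed_tsupport _) hs,
    hs.trans hLU, hf, fun x hx => h1.self_of_nhdsSet x hx, fun i x hx => ?_⟩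
  have : (f : EuclideanSpace ℝ (Fin d) → ℝ) =ᶠ[𝓝 x] fun _ => 1 :=
    h1.filter_mono (nhds_le_nhdsSet hx)
  rw [partialDeriv, this.fderiv_eq]
  simp

end Cutoff

section LocallyIntegrable

variable {d : ℕ} {U : Set (EuclideanSpace ℝ (Fin d))} {f g ψ : EuclideanSpace ℝ (Fin d) → ℝ}

theorem integrable_of_integrableOn_tsupport (h : IntegrableOn f (tsupport ψ))
    (hf : ∀ x ∉ tsupport ψ, f x = 0) : Integrable f := by
  refine (integrableOn_iff_integrable_of_support_subset fun x hx => ?_).1 h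
  by_contra hn
  exact hx (hf x hn)

theorem integrable_mul_of_tsupport_subset (hf : LocallyIntegrableOn f U) (hψ : Continuous ψ)
    (hc : HasCompactSupport ψ) (hs : tsupport ψ ⊆ U) : Integrable (fun x => f x * ψ x) := by
  refine integrable_of_integrableOn_tsupport (ψ := ψ) ?_ fun x hx => ?_
  · exact (hf.integrableOn_compact_subset hs hc.isCompact).mul_continuousOn hψ.continuousOn
      hc.isCompact
  · rw [image_eq_zero_of_notMem_tsupport hx, mul_zero]

theorem locallyIntegrableOn_of_bound (hU : IsOpen U) (hf : LocallyIntegrableOn f U)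
    (hg : AEStronglyMeasurable g (volume.restrict U))
    (h : ∀ᵐ x ∂volume.restrict U, |g x| ≤ |f x|) : LocallyIntegrableOn g U := by
  rw [locallyIntegrableOn_iff hU.isLocallyClosed] at hf ⊢
  intro k hk hkc
  exact Integrable.mono (hf k hk hkc) (hg.mono_measure (Measure.restrict_mono hk le_rfl))
    (ae_restrict_of_ae_restrict_of_subset hk h)

theorem setIntegral_eq_of_tsupport_subset (hs : tsupport ψ ⊆ U)
    (hf : ∀ x ∉ tsupport ψ, f x = 0) : ∫ x in U, f x = ∫ x, f x :=
  setIntegral_eq_integral_of_forall_compl_eq_zero fun x hx => hf x fun h => hx (hs h)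

end LocallyIntegrable

/-! ### Weak partial derivatives and the product rule -/

section WeakPartial

variable {d : ℕ} {U V : Set (EuclideanSpace ℝ (Fin d))} {i : Fin d}
  {f f' g g' ψ ζ : EuclideanSpace ℝ (Fin d) → ℝ}

theorem partialDeriv_eq_zero_of_notMem {x} (hx : x ∉ tsupport ψ) : partialDeriv i ψ x = 0 :=
  image_eq_zero_of_notMem_tsupport fun h => hx (tsupport_partialDeriv_subset h)

theorem HasWeakPartial.integral_eq (h : HasWeakPartial U i f f') (hψ : ContDiff ℝ ∞ ψ)
    (hc : HasCompactSupport ψ) (hs : tsupport ψ ⊆ U) :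
    ∫ x, f x * partialDeriv i ψ x = - ∫ x, f' x * ψ x := by
  have := h.2.2 ψ hψ hc hs
  rwa [setIntegral_eq_of_tsupport_subset hs, setIntegral_eq_of_tsupport_subset hs] at this
  · intro x hx
    rw [image_eq_zero_of_notMem_tsupport hx, mul_zero]
  · intro x hx
    change f x * partialDeriv i ψ x = 0
    rw [partialDeriv_eq_zero_of_notMem hx, mul_zero]

theorem HasWeakPartial.of_integral_eq (hf : LocallyIntegrableOn f U)
    (hf' : LocallyIntegrableOn f' U)
    (h : ∀ ψ : EuclideanSpace ℝ (Fin d) → ℝ, ContDiff ℝ ∞ ψ → HasCompactSupport ψ →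
      tsupport ψ ⊆ U → ∫ x, f x * partialDeriv i ψ x = - ∫ x, f' x * ψ x) :
    HasWeakPartial U i f f' := by
  refine ⟨hf, hf', fun ψ hψ hc hs => ?_⟩
  have := h ψ hψ hc hs
  rwa [setIntegral_eq_of_tsupport_subset hs, setIntegral_eq_of_tsupport_subset hs]
  · intro x hx
    rw [image_eq_zero_of_notMem_tsupport hx, mul_zero]
  · intro x hx
    change f x * partialDeriv i ψ x = 0
    rw [partialDeriv_eq_zero_of_notMem hx, mul_zero]

theorem HasWeakPartial.mono (h : HasWeakPartial U i f f') (hVU : V ⊆ U) :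
    HasWeakPartial V i f f' :=
  .of_integral_eq (h.1.mono_set hVU) (h.2.1.mono_set hVU)
    fun _ hψ hc hs => h.integral_eq hψ hc (hs.trans hVU)

theorem HasWeakPartial.ae_eq (hU : IsOpen U) (h : HasWeakPartial U i f f')
    (h' : HasWeakPartial U i f g') : ∀ᵐ x ∂volume.restrict U, f' x = g' x := by
  rw [ae_restrict_iff' hU.measurableSet]
  have := hU.ae_eq_zero_of_integral_contDiff_smul_eq_zero (f := fun x => f' x - g' x)
    (h.2.1.sub h'.2.1) fun ψ hψ hc hs => ?_
  · filter_upwards [this] with x hx hxU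
    exact sub_eq_zero.1 (hx hxU)
  · have e1 := h.integral_eq hψ hc hs
    have e2 := h'.integral_eq hψ hc hs
    have i1 := integrable_mul_of_tsupport_subset h.2.1 hψ.continuous hc hs
    have i2 := integrable_mul_of_tsupport_subset h'.2.1 hψ.continuous hc hs
    have : ∀ x, ψ x • (f' x - g' x) = f' x * ψ x - g' x * ψ x := fun x => by
      simp only [smul_eq_mul]; ring
    simp_rw [this]
    rw [integral_sub i1 i2]
    linarith

theorem HasWeakPartial.weakPartial_ae_eq (hU : IsOpen U) (h : HasWeakPartial U i f f') :
    ∀ᵐ x ∂volume.restrict U, weakPartial U i f x = f' x := by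
  have hex : ∃ g, HasWeakPartial U i f g := ⟨f', h⟩
  rw [weakPartial, dif_pos hex]
  exact hex.choose_spec.ae_eq hU h

theorem HasWeakPartial.add_const_mul (h : HasWeakPartial U i f f') (h' : HasWeakPartial U i g g')
    (c : ℝ) : HasWeakPartial U i (fun x => f x + c * g x) (fun x => f' x + c * g' x) := by
  have hl : ∀ {k : EuclideanSpace ℝ (Fin d) → ℝ}, LocallyIntegrableOn k U →
      LocallyIntegrableOn (fun x => c * k x) U := fun hk x hx => by
    obtain ⟨t, ht, hi⟩ := hk x hx
    exact ⟨t, ht, hi.const_mul c⟩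
  refine .of_integral_eq (h.1.add (hl h'.1)) (h.2.1.add (hl h'.2.1)) fun ψ hψ hc hs => ?_
  have hs' := (tsupport_partialDeriv_subset (i := i) (ψ := ψ)).trans hs
  have i1 := integrable_mul_of_tsupport_subset h.2.1 hψ.continuous hc hs
  have i2 := integrable_mul_of_tsupport_subset h'.2.1 hψ.continuous hc hs
  have i3 := integrable_mul_of_tsupport_subset h.1 (hψ.partialDeriv (i := i)).continuous
    hc.partialDeriv hs'
  have i4 := integrable_mul_of_tsupport_subset h'.1 (hψ.partialDeriv (i := i)).continuous
    hc.partialDeriv hs'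
  simp only [add_mul, mul_assoc]
  rw [integral_add i3 (i4.const_mul c), integral_add i1 (i2.const_mul c), integral_const_mul,
    integral_const_mul, h.integral_eq hψ hc hs, h'.integral_eq hψ hc hs]
  ring

/-- The weak product rule, tested against a function `ψ` for which `ζ ψ` is supported in `U`. -/
theorem HasWeakPartial.integral_mul_eq (h : HasWeakPartial U i f f') (hζ : ContDiff ℝ ∞ ζ)
    (hψ : ContDiff ℝ ∞ ψ) (hc : IsCompact (tsupport ζ ∩ tsupport ψ))
    (hs : tsupport ζ ∩ tsupport ψ ⊆ U) :
    ∫ x, ζ x * f x * partialDeriv i ψ x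
      = - ∫ x, (partialDeriv i ζ x * f x + ζ x * f' x) * ψ x := by
  have key : ∀ a b : EuclideanSpace ℝ (Fin d) → ℝ, tsupport a ⊆ tsupport ζ →
      tsupport b ⊆ tsupport ψ → HasCompactSupport (fun x => a x * b x) ∧
        tsupport (fun x => a x * b x) ⊆ U := by
    intro a b ha hb
    have : tsupport (fun x => a x * b x) ⊆ tsupport ζ ∩ tsupport ψ :=
      subset_inter ((tsupport_mul_subset_left (f := a) (g := b)).trans ha)
        ((tsupport_mul_subset_right (f := a) (g := b)).trans hb)
    exact ⟨hc.of_isClosed_subset (isClosed_tsupport _) this, this.trans hs⟩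
  obtain ⟨c1, s1⟩ := key ζ ψ subset_rfl subset_rfl
  obtain ⟨c2, s2⟩ := key (partialDeriv i ζ) ψ tsupport_partialDeriv_subset subset_rfl
  obtain ⟨c3, s3⟩ := key ζ (partialDeriv i ψ) subset_rfl tsupport_partialDeriv_subset
  have e := h.integral_eq (hζ.mul hψ) c1 s1
  have i1 := integrable_mul_of_tsupport_subset h.2.1 (hζ.mul hψ).continuous c1 s1
  have i2 := integrable_mul_of_tsupport_subset h.1
    ((hζ.partialDeriv (i := i)).mul hψ).continuous c2 s2
  have i3 := integrable_mul_of_tsupport_subset h.1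
    (hζ.mul (hψ.partialDeriv (i := i))).continuous c3 s3
  have e1 : ∫ x, f x * partialDeriv i (fun y => ζ y * ψ y) x
      = (∫ x, f x * (partialDeriv i ζ x * ψ x)) + ∫ x, f x * (ζ x * partialDeriv i ψ x) := by
    rw [← integral_add i2 i3]
    congr 1 with x
    rw [partialDeriv_mul hζ hψ]
    ring
  have e2 : ∫ x, (partialDeriv i ζ x * f x + ζ x * f' x) * ψ x
      = (∫ x, f x * (partialDeriv i ζ x * ψ x)) + ∫ x, f' x * (ζ x * ψ x) := by
    rw [← integral_add i2 i1]
    congr 1 with x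
    ring
  have e3 : ∫ x, ζ x * f x * partialDeriv i ψ x = ∫ x, f x * (ζ x * partialDeriv i ψ x) := by
    congr 1 with x
    ring
  change ∫ x, f x * partialDeriv i (fun y => ζ y * ψ y) x = _ at e
  rw [e1] at e
  rw [e2, e3]
  linarith

theorem locallyIntegrableOn_smooth_mul (hU : IsOpen U) (hf : LocallyIntegrableOn f U)
    (hζ : Continuous ζ) : LocallyIntegrableOn (fun x => ζ x * f x) U :=
  hf.continuousOn_mul hζ.continuousOn hU.isLocallyClosed

theorem HasWeakPartial.smooth_mul (hU : IsOpen U) (h : HasWeakPartial U i f f')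
    (hζ : ContDiff ℝ ∞ ζ) :
    HasWeakPartial U i (fun x => ζ x * f x)
      (fun x => partialDeriv i ζ x * f x + ζ x * f' x) := by
  refine .of_integral_eq (locallyIntegrableOn_smooth_mul hU h.1 hζ.continuous)
    ((locallyIntegrableOn_smooth_mul hU h.1 (hζ.partialDeriv (i := i)).continuous).add
      (locallyIntegrableOn_smooth_mul hU h.2.1 hζ.continuous)) fun ψ hψ hc hs => ?_
  exact h.integral_mul_eq hζ hψ (hc.isCompact.inter_left (isClosed_tsupport _))
    (inter_subset_right.trans hs)

theorem integrable_cutoff_mul (hf : LocallyIntegrableOn f U) (hψ : Continuous ψ)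
    (hc : HasCompactSupport ψ) (hs : tsupport ψ ⊆ U) : Integrable (fun x => ψ x * f x) := by
  simpa only [mul_comm] using integrable_mul_of_tsupport_subset hf hψ hc hs

theorem HasWeakPartial.integrable_cutoff (h : HasWeakPartial U i f f')
    (hζ : ContDiff ℝ ∞ ζ) (hc : HasCompactSupport ζ) (hs : tsupport ζ ⊆ U) :
    Integrable (fun x => partialDeriv i ζ x * f x + ζ x * f' x) :=
  (integrable_cutoff_mul h.1 (hζ.partialDeriv (i := i)).continuous hc.partialDeriv
      (tsupport_partialDeriv_subset.trans hs)).add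
    (integrable_cutoff_mul h.2.1 hζ.continuous hc hs)

/-- Extension by zero: the cutoff keeps the product supported in `U`, so the test function may be
supported anywhere. This makes mollification on the whole space available. -/
theorem HasWeakPartial.cutoff (h : HasWeakPartial U i f f')
    (hζ : ContDiff ℝ ∞ ζ) (hc : HasCompactSupport ζ) (hs : tsupport ζ ⊆ U) :
    HasWeakPartial univ i (fun x => ζ x * f x)
      (fun x => partialDeriv i ζ x * f x + ζ x * f' x) := by
  refine
    .of_integral_eq
    ((integrable_cutoff_mul h.1 hζ.continuous hc hs).locallyIntegrable.locallyIntegrableOn _)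
    ((h.integrable_cutoff hζ hc hs).locallyIntegrable.locallyIntegrableOn _) fun ψ hψ _ _ => ?_
  exact h.integral_mul_eq hζ hψ (hc.isCompact.inter_right (isClosed_tsupport _))
    (inter_subset_left.trans hs)

theorem partialDeriv_comp_const_sub (hψ : ContDiff ℝ ∞ ψ) (x t) :
    partialDeriv i (fun t => ψ (x - t)) t = - partialDeriv i ψ (x - t) := by
  have h1 : HasFDerivAt ψ (fderiv ℝ ψ (x - t)) (x - t) :=
    (hψ.differentiable (by simp) (x - t)).hasFDerivAt
  have h2 : HasFDerivAt (fun t => ψ (x - t)) _ t :=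
    h1.comp t ((hasFDerivAt_id t).const_sub x)
  rw [partialDeriv, h2.fderiv]
  simp [partialDeriv]

/-- The weak derivative is tested with `ρ(x - ·)`; the sign from the reflection cancels the sign
from the integration by parts. -/
theorem partialDeriv_mollify (h : HasWeakPartial univ i f f') (n : ℕ) (x) :
    partialDeriv i (mollify n f) x = mollify n f' x := by
  have hf : LocallyIntegrable f := locallyIntegrableOn_univ.1 h.1
  rw [mollify, partialDeriv_conv contDiff_mollifier hasCompactSupport_mollifier hf, mollify,
    conv_apply, conv_apply]
  have hψ : ContDiff ℝ ∞ (fun t => mollifier d n (x - t)) :=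
    contDiff_mollifier.comp (contDiff_const.sub contDiff_id)
  have hc : HasCompactSupport (fun t => mollifier d n (x - t)) :=
    hasCompactSupport_mollifier.comp_homeomorph (Homeomorph.subLeft x)
  have e := h.integral_eq hψ hc (subset_univ _)
  simp_rw [partialDeriv_comp_const_sub contDiff_mollifier, mul_neg, integral_neg, neg_inj] at e
  simp_rw [mul_comm _ (f _), mul_comm _ (f' _)]
  exact e

end WeakPartial

/-! ### Chain rule for weak derivatives -/

section ChainRule

variable {d : ℕ} {U : Set (EuclideanSpace ℝ (Fin d))} {i : Fin d}
  {f f' ψ : EuclideanSpace ℝ (Fin d) → ℝ} {Φ : ℝ → ℝ} {M : ℝ}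

theorem abs_sub_le_of_abs_deriv_le (hΦ : ContDiff ℝ 1 Φ) (hM : ∀ t, |deriv Φ t| ≤ M) (a b : ℝ) :
    |Φ a - Φ b| ≤ M * |a - b| :=
  Convex.norm_image_sub_le_of_norm_deriv_le (s := univ)
    (fun x _ => hΦ.differentiable (by simp) x) (fun x _ => hM x) convex_univ (mem_univ b)
    (mem_univ a)

theorem integral_comp_mul_partialDeriv (hf : ContDiff ℝ ∞ f) (hΦ : ContDiff ℝ 1 Φ)
    (hψ : ContDiff ℝ ∞ ψ) (hc : HasCompactSupport ψ) :
    ∫ x, Φ (f x) * partialDeriv i ψ x = - ∫ x, deriv Φ (f x) * partialDeriv i f x * ψ x := by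
  have hΦf : ContDiff ℝ 1 (fun x => Φ (f x)) := hΦ.comp (hf.of_le (by simp))
  have hd : ∀ x, fderiv ℝ (fun x => Φ (f x)) x (EuclideanSpace.single i 1)
      = deriv Φ (f x) * partialDeriv i f x := by
    intro x
    have h1 : HasDerivAt Φ (deriv Φ (f x)) (f x) :=
      (hΦ.differentiable (by simp) (f x)).hasDerivAt
    have h2 : HasFDerivAt f (fderiv ℝ f x) x := (hf.differentiable (by simp) x).hasFDerivAt
    have h3 : HasFDerivAt (fun x => Φ (f x)) (deriv Φ (f x) • fderiv ℝ f x) x :=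
      h1.comp_hasFDerivAt x h2
    rw [h3.fderiv]
    rfl
  have hcont : Continuous (fun x => deriv Φ (f x) * partialDeriv i f x) :=
    ((hΦ.continuous_deriv le_rfl).comp hf.continuous).mul (hf.partialDeriv (i := i)).continuous
  have := integral_mul_fderiv_eq_neg_fderiv_mul_of_integrable (μ := volume)
    (f := fun x => Φ (f x)) (g := ψ) (v := EuclideanSpace.single i (1 : ℝ))
    (by
      simp_rw [hd]
      exact (hcont.mul hψ.continuous).integrable_of_hasCompactSupport hc.mul_left)
    ((hΦf.continuous.mul (hψ.partialDeriv (i := i)).continuous).integrable_of_hasCompactSupport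
      hc.partialDeriv.mul_left)
    ((hΦf.continuous.mul hψ.continuous).integrable_of_hasCompactSupport hc.mul_left)
    (fun x _ => hΦf.differentiable (by simp) x) (fun x _ => hψ.differentiable (by simp) x)
  simp_rw [hd] at this
  exact this

/-- The identity holds for the mollified `f_n`, and the limit is taken after splitting `Φ'(f_n) ∂f_n
= Φ'(f_n) f' + Φ'(f_n) (f'_n - f')`. The first part converges by domination, since `f_n → f` a.e.
and `Φ'` is continuous and bounded; the second tends to 0 because `f'_n → f'` in `L¹`. -/
theorem HasWeakPartial.integral_comp_eq (h : HasWeakPartial univ i f f') (hf : Integrable f)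
    (hf' : Integrable f') (hΦ : ContDiff ℝ 1 Φ) (hM : ∀ t, |deriv Φ t| ≤ M)
    (hψ : ContDiff ℝ ∞ ψ) (hc : HasCompactSupport ψ) :
    ∫ x, Φ (f x) * partialDeriv i ψ x = - ∫ x, deriv Φ (f x) * f' x * ψ x := by
  have hM0 : 0 ≤ M := (abs_nonneg _).trans (hM 0)
  obtain ⟨A, hA⟩ := hc.exists_bound_of_continuous hψ.continuous
  obtain ⟨B, hB⟩ := (hc.partialDeriv (i := i)).exists_bound_of_continuous
    (hψ.partialDeriv (i := i)).continuous
  have hdc : Continuous (deriv Φ) := hΦ.continuous_deriv le_rfl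
  have hψi : Integrable (fun x => Φ (0 : ℝ) * partialDeriv i ψ x) :=
    ((hψ.partialDeriv (i := i)).continuous.integrable_of_hasCompactSupport
      hc.partialDeriv).const_mul _
  have hint : ∀ k : EuclideanSpace ℝ (Fin d) → ℝ, Integrable k →
      Integrable (fun x => Φ (k x) * partialDeriv i ψ x) := by
    intro k hk
    -- Only `Φ(k) - Φ(0)` is controlled by `|k|`; the constant part is integrable thanks to the
    -- compact support of `ψ`.
    have : Integrable (fun x => (Φ (k x) - Φ 0) * partialDeriv i ψ x) := by
      refine (hk.abs.const_mul (M * B)).mono'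
        (((hΦ.continuous.comp_aestronglyMeasurable hk.aestronglyMeasurable).sub
          aestronglyMeasurable_const).mul
          (hψ.partialDeriv (i := i)).continuous.aestronglyMeasurable) (ae_of_all _ fun x => ?_)
      rw [norm_mul]
      calc ‖Φ (k x) - Φ 0‖ * ‖partialDeriv i ψ x‖ ≤ (M * |k x|) * B :=
            mul_le_mul (by simpa using abs_sub_le_of_abs_deriv_le hΦ hM (k x) 0) (hB x)
              (norm_nonneg _) (by positivity)
        _ = M * B * |k x| := by ring
    refine (this.add hψi).congr (ae_of_all _ fun x => ?_)
    simp only [Pi.add_apply]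
    ring
  have hint' : ∀ k l : EuclideanSpace ℝ (Fin d) → ℝ, AEStronglyMeasurable k → Integrable l →
      Integrable (fun x => deriv Φ (k x) * l x * ψ x) ∧
        ∀ x, |deriv Φ (k x) * l x * ψ x| ≤ M * A * |l x| := by
    intro k l hk hl
    have hb : ∀ x, |deriv Φ (k x) * l x * ψ x| ≤ M * A * |l x| := by
      intro x
      rw [abs_mul, abs_mul]
      calc |deriv Φ (k x)| * |l x| * |ψ x| ≤ M * |l x| * A :=
            mul_le_mul (mul_le_mul_of_nonneg_right (hM _) (abs_nonneg _)) (hA x)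
              (abs_nonneg _) (by positivity)
        _ = M * A * |l x| := by ring
    exact ⟨(hl.abs.const_mul (M * A)).mono' (((hdc.comp_aestronglyMeasurable hk).mul
      hl.aestronglyMeasurable).mul hψ.continuous.aestronglyMeasurable) (ae_of_all _ hb), hb⟩
  have hlim1 : Tendsto (fun n => ∫ x, Φ (mollify n f x) * partialDeriv i ψ x) atTop
      (𝓝 (∫ x, Φ (f x) * partialDeriv i ψ x)) := by
    rw [tendsto_iff_dist_tendsto_zero]
    have h0 := (tendsto_integral_abs_mollify_sub hf).const_mul (M * B)
    rw [mul_zero] at h0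
    refine squeeze_zero (fun _ => dist_nonneg) (fun n => ?_) h0
    rw [Real.dist_eq, ← integral_sub (hint _ (integrable_mollify hf)) (hint _ hf),
      ← integral_const_mul]
    refine abs_integral_le_integral_abs.trans (integral_mono
      ((hint _ (integrable_mollify hf)).sub (hint _ hf)).abs
      (((integrable_mollify hf).sub hf).abs.const_mul _) fun x => ?_)
    simp only [← sub_mul, abs_mul]
    calc |Φ (mollify n f x) - Φ (f x)| * |partialDeriv i ψ x|
        ≤ M * |mollify n f x - f x| * B :=
          mul_le_mul (abs_sub_le_of_abs_deriv_le hΦ hM _ _) (hB x) (abs_nonneg _) (by positivity)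
      _ = M * B * |mollify n f x - f x| := by ring
  have hlim2 : Tendsto (fun n => ∫ x, deriv Φ (mollify n f x) * f' x * ψ x) atTop
      (𝓝 (∫ x, deriv Φ (f x) * f' x * ψ x)) := by
    refine tendsto_integral_of_dominated_convergence (fun x => M * A * |f' x|)
      (fun n => (hint' _ _ (integrable_mollify hf).aestronglyMeasurable hf').1.aestronglyMeasurable)
      (hf'.abs.const_mul _)
      (fun n => ae_of_all _ (hint' _ _ (integrable_mollify hf).aestronglyMeasurable hf').2) ?_
    filter_upwards [ae_tendsto_mollify hf.locallyIntegrable] with x hx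
    exact (((hdc.tendsto _).comp hx).mul_const _).mul_const _
  have hlim3 : Tendsto (fun n => ∫ x, deriv Φ (mollify n f x) * (mollify n f' x - f' x) * ψ x)
      atTop (𝓝 0) := by
    have h0 := (tendsto_integral_abs_mollify_sub hf').const_mul (M * A)
    rw [mul_zero] at h0
    refine squeeze_zero_norm (fun n => ?_) h0
    have hi := hint' _ _ (integrable_mollify (n := n) hf).aestronglyMeasurable
      ((integrable_mollify (n := n) hf').sub hf')
    rw [← integral_const_mul]
    exact abs_integral_le_integral_abs.trans (integral_mono hi.1.abs
      (((integrable_mollify hf').sub hf').abs.const_mul _) hi.2)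
  have heq : ∀ n, ∫ x, Φ (mollify n f x) * partialDeriv i ψ x
      = - ((∫ x, deriv Φ (mollify n f x) * f' x * ψ x)
        + ∫ x, deriv Φ (mollify n f x) * (mollify n f' x - f' x) * ψ x) := by
    intro n
    rw [integral_comp_mul_partialDeriv (contDiff_mollify hf.locallyIntegrable) hΦ hψ hc,
      ← integral_add (hint' _ _ (integrable_mollify hf).aestronglyMeasurable hf').1
        (hint' _ (fun x => mollify n f' x - f' x) (integrable_mollify hf).aestronglyMeasurable
          ((integrable_mollify (n := n) hf').sub hf')).1]
    congr 2 with x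
    rw [partialDeriv_mollify h]
    ring
  simp_rw [heq] at hlim1
  have := tendsto_nhds_unique hlim1 (hlim2.add hlim3).neg
  rwa [add_zero] at this

theorem locallyIntegrableOn_comp_of_abs_deriv_le (hU : IsOpen U) (hf : LocallyIntegrableOn f U)
    (hΦ : ContDiff ℝ 1 Φ) (hM : ∀ t, |deriv Φ t| ≤ M) :
    LocallyIntegrableOn (fun x => Φ (f x)) U := by
  rw [locallyIntegrableOn_iff hU.isLocallyClosed] at hf ⊢
  intro k hk hkc
  have h1 := hf k hk hkc
  refine ((h1.abs.const_mul M).add (integrableOn_const (C := |Φ 0|) hkc.measure_lt_top.ne)).mono'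
    (hΦ.continuous.comp_aestronglyMeasurable h1.aestronglyMeasurable) (ae_of_all _ fun x => ?_)
  have h2 := abs_sub_le_of_abs_deriv_le hΦ hM (f x) 0
  rw [sub_zero] at h2
  have h3 := abs_sub_abs_le_abs_sub (Φ (f x)) (Φ 0)
  simp only [Pi.add_apply, Real.norm_eq_abs]
  linarith

/-- The chain rule for weak derivatives. -/
theorem HasWeakPartial.comp (hU : IsOpen U) (h : HasWeakPartial U i f f') (hΦ : ContDiff ℝ 1 Φ)
    (hM : ∀ t, |deriv Φ t| ≤ M) :
    HasWeakPartial U i (fun x => Φ (f x)) (fun x => deriv Φ (f x) * f' x) := by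
  have hM0 : 0 ≤ M := (abs_nonneg _).trans (hM 0)
  refine .of_integral_eq (locallyIntegrableOn_comp_of_abs_deriv_le hU h.1 hΦ hM) ?_
    fun ψ hψ hc hs => ?_
  · have hl : LocallyIntegrableOn (fun x => M * f' x) U :=
      locallyIntegrableOn_smooth_mul hU h.2.1 continuous_const
    refine locallyIntegrableOn_of_bound hU hl
      (((hΦ.continuous_deriv le_rfl).comp_aestronglyMeasurable h.1.aestronglyMeasurable).mul
        h.2.1.aestronglyMeasurable) (ae_of_all _ fun x => ?_)
    rw [abs_mul, abs_mul, abs_of_nonneg hM0]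
    exact mul_le_mul_of_nonneg_right (hM _) (abs_nonneg _)
  -- On the support of `ψ` the cutoff is 1 and its derivative 0, so replacing `f` by `χ f` changes
  -- neither side.
  · obtain ⟨χ, hχ, hχc, hχU, -, hχ1, hχ0⟩ := exists_smooth_cutoff hU hc.isCompact hs
    have e := (h.cutoff hχ hχc hχU).integral_comp_eq
      (integrable_cutoff_mul h.1 hχ.continuous hχc hχU)
      (h.integrable_cutoff hχ hχc hχU) hΦ hM hψ hc
    convert e using 2
    · ext x
      by_cases hx : x ∈ tsupport ψ
      · rw [hχ1 x hx, one_mul]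
      · rw [partialDeriv_eq_zero_of_notMem hx, mul_zero, mul_zero]
    · congr 1 with x
      by_cases hx : x ∈ tsupport ψ
      · rw [hχ1 x hx, hχ0 i x hx, one_mul, zero_mul, zero_add, one_mul]
      · rw [image_eq_zero_of_notMem_tsupport hx, mul_zero, mul_zero]

end ChainRule

/-! ### The planar Sobolev embedding -/

section Sobolev

variable {d : ℕ} {U : Set (EuclideanSpace ℝ (Fin d))} {f ψ : EuclideanSpace ℝ (Fin d) → ℝ}

theorem norm_fderiv_le_sum_abs_partialDeriv (x) :
    ‖fderiv ℝ ψ x‖ ≤ ∑ i, |partialDeriv i ψ x| := by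
  refine ContinuousLinearMap.opNorm_le_bound _ (Finset.sum_nonneg fun i _ => abs_nonneg _)
    fun v => ?_
  have hv : v = ∑ i, v i • EuclideanSpace.single i (1 : ℝ) := by
    ext j
    simp [Pi.single_apply]
  have : fderiv ℝ ψ x v = ∑ i, v i * partialDeriv i ψ x := by
    conv_lhs => rw [hv]
    simp [partialDeriv, map_sum]
  rw [this, Finset.sum_mul]
  refine (Finset.abs_sum_le_sum_abs _ _).trans (Finset.sum_le_sum fun i _ => ?_)
  rw [abs_mul, mul_comm]
  exact mul_le_mul_of_nonneg_left (PiLp.norm_apply_le v i) (abs_nonneg _)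

theorem eLpNorm_fderiv_mollify_le {F' : Fin d → EuclideanSpace ℝ (Fin d) → ℝ}
    (h : ∀ i, HasWeakPartial univ i f (F' i)) (hF' : ∀ i, Integrable (F' i)) (n : ℕ) :
    eLpNorm (fderiv ℝ (mollify n f)) 1 volume ≤ ENNReal.ofReal (∑ i, ∫ x, |F' i x|) := by
  have hb : ∀ x, ‖fderiv ℝ (mollify n f) x‖ ≤ ∑ i, |mollify n (F' i) x| := by
    intro x
    simp_rw [← partialDeriv_mollify (h _)]
    exact norm_fderiv_le_sum_abs_partialDeriv x
  have hi : Integrable (fun x => ∑ i, |mollify n (F' i) x|) :=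
    integrable_finsetSum _ fun i _ => (integrable_mollify (hF' i)).abs
  calc eLpNorm (fderiv ℝ (mollify n f)) 1 volume
      ≤ eLpNorm (fun x => ∑ i, |mollify n (F' i) x|) 1 volume := eLpNorm_mono_real hb
    _ = ENNReal.ofReal (∫ x, ∑ i, |mollify n (F' i) x|) := by
      rw [eLpNorm_one_eq_lintegral_enorm, ← ofReal_integral_norm_eq_lintegral_enorm hi]
      congr 2 with x
      exact Real.norm_of_nonneg (Finset.sum_nonneg fun i _ => abs_nonneg _)
    _ ≤ _ := by
      rw [integral_finsetSum _ fun i _ => (integrable_mollify (hF' i)).abs]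
      exact ENNReal.ofReal_le_ofReal (Finset.sum_le_sum fun i _ => integral_abs_mollify_le (hF' i))

/-- The Sobolev embedding `W^{1,1}_loc ⊆ L²_loc` in the plane. -/
theorem memLpLoc_two_of_hasWeakPartial {U : Set (EuclideanSpace ℝ (Fin 2))} (hU : IsOpen U)
    {f : EuclideanSpace ℝ (Fin 2) → ℝ} {f' : Fin 2 → EuclideanSpace ℝ (Fin 2) → ℝ}
    (h : ∀ i, HasWeakPartial U i f (f' i)) : MemLpLoc 2 U f := by
  intro K hK hKU
  obtain ⟨χ, hχ, hχc, hχU, -, hχ1, -⟩ := exists_smooth_cutoff hU hK hKU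
  have hFi : Integrable (fun x => χ x * f x) :=
    integrable_cutoff_mul (h 0).1 hχ.continuous hχc hχU
  have hcs : HasCompactSupport (fun x => χ x * f x) := hχc.mul_right
  -- Gagliardo–Nirenberg–Sobolev for smooth compactly supported functions: the exponent conjugate to
  -- the dimension 2 is again 2. The bound does not depend on `n`, so it passes to the a.e. limit by
  -- Fatou.
  have hbound : ∀ n, eLpNorm (mollify n (fun x => χ x * f x)) 2 volume ≤
      eLpNormLESNormFDerivOneConst (volume : Measure (EuclideanSpace ℝ (Fin 2))) (2 : NNReal) *
        ENNReal.ofReal (∑ i, ∫ x, |partialDeriv i χ x * f x + χ x * f' i x|) := by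
    intro n
    have hp : NNReal.HolderConjugate (Module.finrank ℝ (EuclideanSpace ℝ (Fin 2))) 2 := by
      rw [finrank_euclideanSpace_fin]
      exact NNReal.HolderConjugate.two_two
    refine (eLpNorm_le_eLpNorm_fderiv_one volume
      ((contDiff_mollify hFi.locallyIntegrable).of_le (by simp))
      (hasCompactSupport_mollify hcs) hp).trans ?_
    gcongr
    exact eLpNorm_fderiv_mollify_le (fun i => (h i).cutoff hχ hχc hχU)
      (fun i => (h i).integrable_cutoff hχ hχc hχU) n
  have hm : MemLp (fun x => χ x * f x) 2 volume := by
    refine ⟨hFi.aestronglyMeasurable, ?_⟩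
    exact (Lp.eLpNorm_le_of_ae_tendsto (Eventually.of_forall hbound)
      (fun n => (integrable_mollify (n := n) hFi).aestronglyMeasurable)
      (ae_tendsto_mollify hFi.locallyIntegrable)).trans_lt
      (ENNReal.mul_lt_top ENNReal.coe_lt_top ENNReal.ofReal_lt_top)
  refine (hm.restrict K).ae_eq ?_
  filter_upwards [ae_restrict_mem hK.measurableSet] with x hx
  rw [hχ1 x hx, one_mul]

end Sobolev

/-! ### First variation of the energy -/

section FirstVariation

theorem memLp_bdd_mul {α : Type*} [MeasurableSpace α] {ν : Measure α} {p : ℝ≥0∞} {f g : α → ℝ}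
    {C : ℝ} (hg : MemLp g p ν) (hf : AEStronglyMeasurable f ν) (hC : ∀ x, |f x| ≤ C) :
    MemLp (fun x => f x * g x) p ν := by
  refine hg.of_le_mul (c := C) (hf.mul hg.aestronglyMeasurable) (ae_of_all _ fun x => ?_)
  rw [norm_mul]
  exact mul_le_mul_of_nonneg_right (hC x) (norm_nonneg _)

theorem memLp_top_mul_integrable {α : Type*} [MeasurableSpace α] {ν : Measure α} {f g : α → ℝ}
    (hf : MemLp f ∞ ν) (hg : Integrable g ν) : Integrable (fun x => f x * g x) ν :=
  memLp_one_iff_integrable.1 ((memLp_one_iff_integrable.2 hg).mul hf)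

variable {d : ℕ} {U K : Set (EuclideanSpace ℝ (Fin d))} {g u φ ζ : EuclideanSpace ℝ (Fin d) → ℝ}
  {u' φ' : Fin d → EuclideanSpace ℝ (Fin d) → ℝ}

/-- Along a line the energy is a quadratic polynomial in `ε`, so its derivative at 0 is read off
from the linear coefficient. The chosen version `weakPartial` is replaced by the given derivatives
almost everywhere. -/
theorem obstacleEnergy_add_const_mul (hU : IsOpen U) (hKU : K ⊆ U)
    (hu : ∀ i, HasWeakPartial U i u (u' i)) (hu' : ∀ i, MemLp (u' i) 2 (volume.restrict U))
    (hub : MemLp u ∞ (volume.restrict K)) (hg : IntegrableOn g K)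
    (hφ : ∀ i, HasWeakPartial U i φ (φ' i)) (hφ' : ∀ i, MemLp (φ' i) 2 (volume.restrict U))
    (hφb : MemLp φ ∞ (volume.restrict K)) (ε : ℝ) :
    obstacleEnergy U K g (fun x => u x + ε * φ x)
      = ((∑ i, ∫ x in K, u' i x ^ 2) + ∫ x in K, (u x ^ 2 - 2 * u x) * g x)
        + ε * (2 * ((∑ i, ∫ x in K, u' i x * φ' i x) + ∫ x in K, (u x - 1) * φ x * g x))
        + ε ^ 2 * ((∑ i, ∫ x in K, φ' i x ^ 2) + ∫ x in K, φ x ^ 2 * g x) := by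
  have m1 : ∀ i, MemLp (u' i) 2 (volume.restrict K) := fun i =>
    (hu' i).mono_measure (Measure.restrict_mono hKU le_rfl)
  have m2 : ∀ i, MemLp (φ' i) 2 (volume.restrict K) := fun i =>
    (hφ' i).mono_measure (Measure.restrict_mono hKU le_rfl)
  have e1 : ∫ x in K, ∑ i, weakPartial U i (fun x => u x + ε * φ x) x ^ 2
      = ∑ i, ((∫ x in K, u' i x ^ 2) + ε * (2 * ∫ x in K, u' i x * φ' i x)
        + ε ^ 2 * ∫ x in K, φ' i x ^ 2) := by
    have hae : ∀ᵐ x ∂volume.restrict K, ∑ i, weakPartial U i (fun x => u x + ε * φ x) x ^ 2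
        = ∑ i, (u' i x ^ 2 + (ε * 2) * (u' i x * φ' i x) + ε ^ 2 * φ' i x ^ 2) := by
      have : ∀ᵐ x ∂volume.restrict K, ∀ i,
          weakPartial U i (fun x => u x + ε * φ x) x = u' i x + ε * φ' i x :=
        ae_all_iff.2 fun i => ae_restrict_of_ae_restrict_of_subset hKU
          (((hu i).add_const_mul (hφ i) ε).weakPartial_ae_eq hU)
      filter_upwards [this] with x hx
      refine Finset.sum_congr rfl fun i _ => ?_
      rw [hx i]
      ring
    have i1 : ∀ i, IntegrableOn (fun x => u' i x ^ 2) K := fun i => (m1 i).integrable_sq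
    have i2 : ∀ i, IntegrableOn (fun x => (ε * 2) * (u' i x * φ' i x)) K := fun i =>
      ((m1 i).integrable_mul (m2 i)).const_mul _
    have i3 : ∀ i, IntegrableOn (fun x => ε ^ 2 * φ' i x ^ 2) K := fun i =>
      (m2 i).integrable_sq.const_mul _
    have i12 : ∀ i, IntegrableOn (fun x => u' i x ^ 2 + (ε * 2) * (u' i x * φ' i x)) K :=
      fun i => (i1 i).add (i2 i)
    have i123 : ∀ i, IntegrableOn (fun x => u' i x ^ 2 + (ε * 2) * (u' i x * φ' i x)
        + ε ^ 2 * φ' i x ^ 2) K := fun i => (i12 i).add (i3 i)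
    rw [integral_congr_ae hae, integral_finsetSum _ fun i _ => i123 i]
    refine Finset.sum_congr rfl fun i _ => ?_
    rw [integral_add (i12 i) (i3 i), integral_add (i1 i) (i2 i), integral_const_mul,
      integral_const_mul]
    ring
  have e2 : ∫ x in K, ((u x + ε * φ x) ^ 2 - 2 * (u x + ε * φ x)) * g x
      = (∫ x in K, (u x ^ 2 - 2 * u x) * g x) + ε * (2 * ∫ x in K, (u x - 1) * φ x * g x)
        + ε ^ 2 * ∫ x in K, φ x ^ 2 * g x := by
    have u2 : MemLp (fun x => u x ^ 2) ∞ (volume.restrict K) := by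
      simpa only [sq] using! hub.mul (r := ∞) hub
    have φ2 : MemLp (fun x => φ x ^ 2) ∞ (volume.restrict K) := by
      simpa only [sq] using! hφb.mul (r := ∞) hφb
    have uφ : MemLp (fun x => u x * φ x) ∞ (volume.restrict K) := hφb.mul (r := ∞) hub
    have i1 : IntegrableOn (fun x => (u x ^ 2 - 2 * u x) * g x) K :=
      memLp_top_mul_integrable (u2.sub (hub.const_mul 2)) hg
    have i2 : IntegrableOn (fun x => (ε * 2) * ((u x - 1) * φ x * g x)) K := by
      have : MemLp (fun x => (u x - 1) * φ x) ∞ (volume.restrict K) := by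
        simpa only [sub_mul, one_mul] using! uφ.sub hφb
      exact (memLp_top_mul_integrable this hg).const_mul _
    have i3 : IntegrableOn (fun x => ε ^ 2 * (φ x ^ 2 * g x)) K :=
      (memLp_top_mul_integrable φ2 hg).const_mul _
    have i12 : IntegrableOn (fun x => (u x ^ 2 - 2 * u x) * g x
        + (ε * 2) * ((u x - 1) * φ x * g x)) K := i1.add i2
    have : ∀ x, ((u x + ε * φ x) ^ 2 - 2 * (u x + ε * φ x)) * g x
        = (u x ^ 2 - 2 * u x) * g x + (ε * 2) * ((u x - 1) * φ x * g x)
          + ε ^ 2 * (φ x ^ 2 * g x) := fun x => by ring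
    simp_rw [this]
    rw [integral_add i12 i3, integral_add i1 i2, integral_const_mul, integral_const_mul]
    ring
  rw [obstacleEnergy, e1, e2]
  simp only [Finset.sum_add_distrib, ← Finset.mul_sum]
  ring

theorem IsObstacleCriticalPoint.firstVariation_nonneg (hcrit : IsObstacleCriticalPoint U g u)
    (hU : IsOpen U) (hK : IsCompact K) (hKU : K ⊆ U)
    (hu : ∀ i, HasWeakPartial U i u (u' i)) (hu' : ∀ i, MemLp (u' i) 2 (volume.restrict U))
    (hub : MemLp u ∞ (volume.restrict K)) (hg : IntegrableOn g K)
    (hφ2 : MemLp φ 2 (volume.restrict U))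
    (hφ : ∀ i, HasWeakPartial U i φ (φ' i)) (hφ' : ∀ i, MemLp (φ' i) 2 (volume.restrict U))
    (hφb : MemLp φ ∞ (volume.restrict U))
    (h0 : ∀ᵐ x ∂(volume.restrict (U \ K)), φ x = 0)
    (hadm : ∃ ε₀ > (0 : ℝ), ∀ ε ∈ Icc 0 ε₀, ∀ᵐ x ∂(volume.restrict U), 0 ≤ u x + ε * φ x) :
    0 ≤ (∑ i, ∫ x in K, u' i x * φ' i x) + ∫ x in K, (u x - 1) * φ x * g x := by
  obtain ⟨D, hD, hderiv⟩ := hcrit.2 K φ hK hKU ⟨hφ2, fun i => ⟨φ' i, hφ i, hφ' i⟩⟩ hφb h0 hadm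
  set a := (∑ i, ∫ x in K, u' i x ^ 2) + ∫ x in K, (u x ^ 2 - 2 * u x) * g x
  set b := (∑ i, ∫ x in K, u' i x * φ' i x) + ∫ x in K, (u x - 1) * φ x * g x
  set c := (∑ i, ∫ x in K, φ' i x ^ 2) + ∫ x in K, φ x ^ 2 * g x
  have hE : (fun ε : ℝ => obstacleEnergy U K g (fun x => u x + ε * φ x))
      = fun ε => a + ε * (2 * b) + ε ^ 2 * c := by
    ext ε
    exact obstacleEnergy_add_const_mul hU hKU hu hu' hub hg hφ hφ'
      (hφb.mono_measure (Measure.restrict_mono hKU le_rfl)) ε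
  rw [hE] at hderiv
  have h1 : HasDerivAt (fun ε : ℝ => a + ε * (2 * b) + ε ^ 2 * c) (2 * b) 0 := by
    have := (((hasDerivAt_id (0 : ℝ)).mul_const (2 * b)).const_add a).add
      (((hasDerivAt_id (0 : ℝ)).pow 2).mul_const c)
    simpa using! this
  have := (uniqueDiffWithinAt_Ici (0 : ℝ)).eq_deriv _ hderiv h1.hasDerivWithinAt
  linarith

/-- The first variation in the direction `ζ Θ(u)`. -/
theorem IsObstacleCriticalPoint.firstVariation_smooth_mul_comp
    (hcrit : IsObstacleCriticalPoint U g u) (hU : IsOpen U) (hu2 : MemLp u 2 (volume.restrict U))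
    (hu : ∀ i, HasWeakPartial U i u (u' i)) (hu' : ∀ i, MemLp (u' i) 2 (volume.restrict U))
    (hub : MemLpLoc ∞ U u) (hg : LocallyIntegrableOn g U)
    (hζ : ContDiff ℝ ∞ ζ) (hc : HasCompactSupport ζ) (hs : tsupport ζ ⊆ U) (hζ0 : ∀ x, 0 ≤ ζ x)
    {Θ : ℝ → ℝ} {M C : ℝ} (hΘ : ContDiff ℝ 1 Θ) (hM : ∀ t, |Θ t| ≤ M)
    (hM' : ∀ t, |deriv Θ t| ≤ M) (hC : ∀ t, 0 ≤ t → -(C * t) ≤ Θ t) (hC0 : 0 ≤ C) :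
    0 ≤ (∑ i, ∫ x, u' i x * (partialDeriv i ζ x * Θ (u x) + ζ x * (deriv Θ (u x) * u' i x)))
      + ∫ x, (u x - 1) * (ζ x * Θ (u x)) * g x := by
  obtain ⟨A, hA⟩ := hc.exists_bound_of_continuous hζ.continuous
  have hA0 : 0 ≤ A := (norm_nonneg _).trans (hA 0)
  have hum : ∀ F : ℝ → ℝ, Continuous F →
      AEStronglyMeasurable (fun x => F (u x)) (volume.restrict U) := by
    intro F hF
    exact hF.comp_aestronglyMeasurable hu2.aestronglyMeasurable
  have hΘu := hum Θ hΘ.continuous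
  have hΘu' := hum (deriv Θ) (hΘ.continuous_deriv le_rfl)
  have hL2 : ∀ ξ : EuclideanSpace ℝ (Fin d) → ℝ, Continuous ξ → HasCompactSupport ξ → ∀ p,
      MemLp (fun x => Θ (u x) * ξ x) p (volume.restrict U) := fun ξ hξ hξc p =>
    memLp_bdd_mul ((hξ.memLp_of_hasCompactSupport hξc).restrict U) hΘu fun x => hM (u x)
  have hK := hc.isCompact
  have := hcrit.firstVariation_nonneg (φ := fun x => ζ x * Θ (u x))
    (φ' := fun i x => partialDeriv i ζ x * Θ (u x) + ζ x * (deriv Θ (u x) * u' i x))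
    hU hK hs hu hu' (hub _ hK hs) (hg.integrableOn_compact_subset hs hK)
    (by simpa only [mul_comm] using hL2 ζ hζ.continuous hc 2)
    (fun i => ((hu i).comp hU hΘ hM').smooth_mul hU hζ)
    (fun i => by
      have h1 := hL2 _ (hζ.partialDeriv (i := i)).continuous hc.partialDeriv 2
      simp only [mul_comm (Θ _)] at h1
      refine h1.add ?_
      exact memLp_bdd_mul (memLp_bdd_mul (hu' i) hΘu' fun x => hM' (u x))
        hζ.continuous.aestronglyMeasurable hA)
    (by simpa only [mul_comm] using hL2 ζ hζ.continuous hc ∞)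
    (by
      filter_upwards [ae_restrict_mem (hU.measurableSet.diff hK.measurableSet)] with x hx
      rw [image_eq_zero_of_notMem_tsupport hx.2, zero_mul])
    (by
      -- With `0 ≤ ζ ≤ A` and `Θ(u) ≥ -C u`, one has `u + ε ζ Θ(u) ≥ (1 - ε A C) u ≥ 0`; the `+ 1`
      -- keeps the denominator positive when `A C = 0`.
      refine ⟨1 / (A * C + 1), by positivity, fun ε hε => ?_⟩
      filter_upwards [hcrit.1] with x hx
      have h1 : ε * (A * C + 1) ≤ 1 := by
        have := hε.2
        rwa [le_div_iff₀ (by positivity)] at this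
      have h2 := hC (u x) hx
      have h3 : ζ x ≤ A := (le_abs_self _).trans (hA x)
      have h4 : ζ x * -(C * u x) ≤ ζ x * Θ (u x) := mul_le_mul_of_nonneg_left h2 (hζ0 x)
      have h5 : ζ x * (C * u x) ≤ A * (C * u x) :=
        mul_le_mul_of_nonneg_right h3 (mul_nonneg hC0 hx)
      have h6 : ε * (-(A * (C * u x))) ≤ ε * (ζ x * Θ (u x)) :=
        mul_le_mul_of_nonneg_left (by linarith) hε.1
      have h7 : ε * (A * C + 1) * u x ≤ 1 * u x := mul_le_mul_of_nonneg_right h1 hx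
      nlinarith [mul_nonneg hε.1 hx])
  have e : ∀ F : EuclideanSpace ℝ (Fin d) → ℝ, (∀ x ∉ tsupport ζ, F x = 0) →
      ∫ x in tsupport ζ, F x = ∫ x, F x := fun F hF =>
    setIntegral_eq_integral_of_forall_compl_eq_zero hF
  rw [e _ fun x hx => by rw [image_eq_zero_of_notMem_tsupport hx]; simp] at this
  simp_rw [fun i => e (fun x => u' i x * (partialDeriv i ζ x * Θ (u x) + ζ x *
    (deriv Θ (u x) * u' i x))) fun x hx => by
      rw [image_eq_zero_of_notMem_tsupport hx, partialDeriv_eq_zero_of_notMem hx]; simp] at this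
  exact this

end FirstVariation

/-! ### The truncation `T_δ` and its primitive `P_δ` -/

section Truncation

/-- The smooth truncation `t ↦ (t/δ)² / (1 + (t/δ)²)`, an approximation of `1_{t ≠ 0}`. -/
noncomputable def truncation (δ t : ℝ) : ℝ := 1 - (1 + (t / δ) ^ 2)⁻¹

/-- A primitive of `truncation δ`, at distance `O(δ)` of the identity. -/
noncomputable def truncationPrimitive (δ t : ℝ) : ℝ := t - δ * Real.arctan (t / δ)

variable {δ : ℝ}

theorem truncation_nonneg (t : ℝ) : 0 ≤ truncation δ t := by
  have : (1 + (t / δ) ^ 2)⁻¹ ≤ 1 := inv_le_one_of_one_le₀ (by nlinarith [sq_nonneg (t / δ)])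
  rw [truncation]
  linarith

theorem truncation_le_one (t : ℝ) : truncation δ t ≤ 1 := by
  have : 0 ≤ (1 + (t / δ) ^ 2)⁻¹ := by positivity
  rw [truncation]
  linarith

/-- With `s = t / δ` this is `s² / (1 + s²) ≤ s`. The linear bound at 0 is what makes `-ζ T_δ(u)` an
admissible direction. -/
theorem truncation_le (hδ : 0 < δ) {t : ℝ} (ht : 0 ≤ t) : truncation δ t ≤ δ⁻¹ * t := by
  have hs : 0 ≤ t / δ := by positivity
  rw [truncation, inv_mul_eq_div]
  set s := t / δ
  have h1 : 0 < 1 + s ^ 2 := by positivity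
  have : 1 - (1 + s ^ 2)⁻¹ = s ^ 2 / (1 + s ^ 2) := by field_simp; ring
  rw [this, div_le_iff₀ h1]
  nlinarith [mul_nonneg hs (sq_nonneg (s - 1)), mul_nonneg hs hs]

theorem contDiff_truncation : ContDiff ℝ 1 (truncation δ) := by
  unfold truncation
  refine contDiff_const.sub (ContDiff.inv (by fun_prop) fun t => ?_)
  positivity

theorem contDiff_truncationPrimitive : ContDiff ℝ 1 (truncationPrimitive δ) := by
  unfold truncationPrimitive
  exact contDiff_id.sub (contDiff_const.mul (Real.contDiff_arctan.comp (contDiff_id.div_const δ)))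

theorem deriv_truncationPrimitive (hδ : 0 < δ) (t : ℝ) :
    deriv (truncationPrimitive δ) t = truncation δ t := by
  have h1 : HasDerivAt (fun t : ℝ => t / δ) (1 / δ) t := (hasDerivAt_id t).div_const δ
  have h2 := (hasDerivAt_id t).sub ((h1.arctan).const_mul δ)
  have h3 : HasDerivAt (truncationPrimitive δ) _ t := h2
  rw [h3.deriv, truncation]
  field_simp

theorem deriv_truncation (t : ℝ) :
    deriv (truncation δ) t = 2 * (t / δ) * δ⁻¹ / (1 + (t / δ) ^ 2) ^ 2 := by
  have h1 : HasDerivAt (fun t : ℝ => t / δ) (1 / δ) t := (hasDerivAt_id t).div_const δ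
  have h0 : 1 + (t / δ) ^ 2 ≠ 0 := by positivity
  have h2 := (((h1.pow 2).const_add 1).inv h0).const_sub 1
  have h3 : HasDerivAt (truncation δ) _ t := h2
  rw [h3.deriv]
  simp
  ring

theorem deriv_truncation_nonneg (hδ : 0 < δ) {t : ℝ} (ht : 0 ≤ t) :
    0 ≤ deriv (truncation δ) t := by
  rw [deriv_truncation]
  positivity

theorem abs_deriv_truncation_le (hδ : 0 < δ) (t : ℝ) : |deriv (truncation δ) t| ≤ δ⁻¹ := by
  rw [deriv_truncation]
  set s := t / δ
  have h1 : 0 < (1 + s ^ 2) ^ 2 := by positivity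
  have hd : 0 < δ⁻¹ := by positivity
  rw [abs_div, abs_of_pos h1, div_le_iff₀ h1, abs_mul, abs_of_pos hd, mul_comm]
  refine mul_le_mul_of_nonneg_left ?_ hd.le
  rw [abs_le]
  constructor <;> nlinarith [sq_nonneg (s - 1), sq_nonneg (s + 1), sq_nonneg (s ^ 2)]

theorem abs_truncationPrimitive_sub_le (hδ : 0 < δ) (t : ℝ) :
    |truncationPrimitive δ t - t| ≤ 2 * δ := by
  have h : |Real.arctan (t / δ)| ≤ 2 := by
    rw [abs_le]
    constructor <;> linarith [Real.arctan_lt_pi_div_two (t / δ),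
      Real.neg_pi_div_two_lt_arctan (t / δ),
      Real.pi_le_four]
  rw [truncationPrimitive, sub_sub_cancel_left, abs_neg, abs_mul, abs_of_pos hδ, mul_comm]
  exact mul_le_mul_of_nonneg_right h hδ.le

end Truncation

/-! ### Two-sided weak bound on the Laplacian -/

section LaplacianBound

/-- The Laplacian `∑ᵢ ∂ᵢ∂ᵢ ψ`. -/
noncomputable def coordLaplacian {d : ℕ} (ψ : EuclideanSpace ℝ (Fin d) → ℝ)
    (x : EuclideanSpace ℝ (Fin d)) : ℝ :=
  ∑ i, partialDeriv i (partialDeriv i ψ) x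

variable {d : ℕ} {U : Set (EuclideanSpace ℝ (Fin d))} {g u ζ : EuclideanSpace ℝ (Fin d) → ℝ}
  {u' : Fin d → EuclideanSpace ℝ (Fin d) → ℝ}

theorem ContDiff.coordLaplacian (hζ : ContDiff ℝ ∞ ζ) : ContDiff ℝ ∞ (coordLaplacian ζ) :=
  ContDiff.sum fun _ _ => hζ.partialDeriv.partialDeriv

theorem coordLaplacian_eq_zero_of_notMem {x} (hx : x ∉ tsupport ζ) : coordLaplacian ζ x = 0 :=
  Finset.sum_eq_zero fun _ _ =>
    partialDeriv_eq_zero_of_notMem fun h => hx (tsupport_partialDeriv_subset h)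

theorem tsupport_coordLaplacian_subset : tsupport (coordLaplacian ζ) ⊆ tsupport ζ :=
  closure_minimal (fun _ hx => by_contra fun h => hx (coordLaplacian_eq_zero_of_notMem h))
    (isClosed_tsupport ζ)

theorem HasCompactSupport.coordLaplacian (hc : HasCompactSupport ζ) :
    HasCompactSupport (coordLaplacian ζ) :=
  hc.isCompact.of_isClosed_subset (isClosed_tsupport _) tsupport_coordLaplacian_subset

theorem sum_integral_mul_partialDeriv (hu : ∀ i, HasWeakPartial U i u (u' i))
    (hul : LocallyIntegrableOn u U)
    (hζ : ContDiff ℝ ∞ ζ) (hc : HasCompactSupport ζ) (hs : tsupport ζ ⊆ U) :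
    ∑ i, ∫ x, u' i x * partialDeriv i ζ x = - ∫ x, u x * coordLaplacian ζ x := by
  simp only [coordLaplacian, Finset.mul_sum]
  rw [integral_finsetSum, ← Finset.sum_neg_distrib]
  · refine Finset.sum_congr rfl fun i _ => ?_
    rw [(hu i).integral_eq hζ.partialDeriv hc.partialDeriv (tsupport_partialDeriv_subset.trans hs),
      neg_neg]
  · intro i _
    exact integrable_mul_of_tsupport_subset hul (hζ.partialDeriv (i := i)).partialDeriv.continuous
      hc.partialDeriv.partialDeriv
      (tsupport_partialDeriv_subset.trans (tsupport_partialDeriv_subset.trans hs))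

theorem locallyIntegrableOn_top_mul (hU : IsOpen U) (hub : MemLpLoc ∞ U u)
    (hg : LocallyIntegrableOn g U) : LocallyIntegrableOn (fun x => (u x - 1) * g x) U := by
  rw [locallyIntegrableOn_iff hU.isLocallyClosed] at hg ⊢
  intro K hK hKc
  exact memLp_top_mul_integrable ((hub K hKc hK).sub (memLp_top_const 1)) (hg K hK hKc)

theorem MeasureTheory.MemLp.locallyIntegrableOn_two (hu : MemLp u 2 (volume.restrict U)) :
    LocallyIntegrableOn u U :=
  locallyIntegrableOn_of_locallyIntegrable_restrict (hu.locallyIntegrable (by norm_num))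

variable (hcrit : IsObstacleCriticalPoint U g u) (hU : IsOpen U)
    (hu2 : MemLp u 2 (volume.restrict U))
    (hu : ∀ i, HasWeakPartial U i u (u' i)) (hu' : ∀ i, MemLp (u' i) 2 (volume.restrict U))
    (hub : MemLpLoc ∞ U u) (hg : LocallyIntegrableOn g U)
    (hζ : ContDiff ℝ ∞ ζ) (hc : HasCompactSupport ζ) (hs : tsupport ζ ⊆ U) (hζ0 : ∀ x, 0 ≤ ζ x)

include hcrit hU hu2 hu hu' hub hg hζ hc hs hζ0

/-- Raising `u` is always allowed: the direction `ζ`, that is `Θ = 1`, gives `-Δu + (u - 1) g ≥ 0`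
weakly. -/
theorem IsObstacleCriticalPoint.integral_mul_coordLaplacian_le :
    ∫ x, u x * coordLaplacian ζ x ≤ ∫ x, |(u x - 1) * g x| * ζ x := by
  have h := hcrit.firstVariation_smooth_mul_comp hU hu2 hu hu' hub hg hζ hc hs hζ0
    (Θ := fun _ => 1) (M := 1) (C := 0) contDiff_const (by simp) (by simp) (by simp) le_rfl
  simp only [mul_one, deriv_const', zero_mul, mul_zero, add_zero] at h
  rw [sum_integral_mul_partialDeriv hu hu2.locallyIntegrableOn_two hζ hc hs] at h
  have hi := integrable_mul_of_tsupport_subset (locallyIntegrableOn_top_mul hU hub hg)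
    hζ.continuous hc hs
  have e : ∀ x, (u x - 1) * ζ x * g x = (u x - 1) * g x * ζ x := fun x => by ring
  simp_rw [e] at h
  have h2 : ∫ x, (u x - 1) * g x * ζ x ≤ ∫ x, |(u x - 1) * g x| * ζ x := by
    refine integral_mono hi (hi.abs.congr (ae_of_all _ fun x => ?_)) fun x =>
      mul_le_mul_of_nonneg_right (le_abs_self _) (hζ0 x)
    simp only [abs_mul, abs_of_nonneg (hζ0 x)]
  linarith

/-- The direction is `-ζ T_δ(u)`. Its gradient contributes `-T_δ(u) ∇u · ∇ζ = -∇P_δ(u) · ∇ζ` and `-ζ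
T_δ'(u) |∇u|² ≤ 0`, which is discarded; in the zeroth-order term `0 ≤ T_δ ≤ 1`. -/
theorem IsObstacleCriticalPoint.neg_integral_truncationPrimitive_le {δ : ℝ} (hδ : 0 < δ) :
    - ∫ x, truncationPrimitive δ (u x) * coordLaplacian ζ x
      ≤ ∫ x, |(u x - 1) * g x| * ζ x := by
  have hd : ∀ t, deriv (fun t => -truncation δ t) t = - deriv (truncation δ) t := fun t => by
    rw [deriv.fun_neg]
  have hθ1 : ∀ t, |truncation δ t| ≤ 1 := fun t =>
    abs_le.2 ⟨by linarith [truncation_nonneg (δ := δ) t], truncation_le_one t⟩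
  have h := hcrit.firstVariation_smooth_mul_comp hU hu2 hu hu' hub hg hζ hc hs hζ0
    (Θ := fun t => -truncation δ t) (M := 1 + δ⁻¹) (C := δ⁻¹) contDiff_truncation.neg
    (fun t => by rw [abs_neg]; have := hθ1 t; have : 0 < δ⁻¹ := by positivity
                 linarith)
    (fun t => by rw [hd, abs_neg]; have := abs_deriv_truncation_le hδ t; linarith)
    (fun t ht => neg_le_neg (truncation_le hδ ht)) (by positivity)
  simp_rw [hd] at h
  have hv : ∀ i, HasWeakPartial U i (fun x => truncationPrimitive δ (u x))
      (fun x => truncation δ (u x) * u' i x) := by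
    intro i
    have := (hu i).comp hU (contDiff_truncationPrimitive (δ := δ)) (M := 1)
      (fun t => by rw [deriv_truncationPrimitive hδ]; exact hθ1 t)
    simpa only [deriv_truncationPrimitive hδ] using this
  have hvl : LocallyIntegrableOn (fun x => truncationPrimitive δ (u x)) U :=
    locallyIntegrableOn_comp_of_abs_deriv_le hU hu2.locallyIntegrableOn_two
      contDiff_truncationPrimitive (M := 1)
      (fun t => by rw [deriv_truncationPrimitive hδ]; exact hθ1 t)
  have hsum := sum_integral_mul_partialDeriv hv hvl hζ hc hs
  have hle : ∀ i, ∫ x, u' i x * (partialDeriv i ζ x * -truncation δ (u x)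
        + ζ x * (-deriv (truncation δ) (u x) * u' i x))
      ≤ - ∫ x, truncation δ (u x) * u' i x * partialDeriv i ζ x := by
    intro i
    have i1 := integrable_mul_of_tsupport_subset (hv i).2.1 (hζ.partialDeriv (i := i)).continuous
      hc.partialDeriv (tsupport_partialDeriv_subset.trans hs)
    have l2 : LocallyIntegrableOn (fun x => deriv (truncation δ) (u x) * u' i x ^ 2) U := by
      have : LocallyIntegrableOn (fun x => δ⁻¹ * u' i x ^ 2) U :=
        IntegrableOn.locallyIntegrableOn ((hu' i).integrable_sq.const_mul δ⁻¹)
      refine locallyIntegrableOn_of_bound hU this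
        (((contDiff_truncation.continuous_deriv le_rfl).comp_aestronglyMeasurable
          hu2.aestronglyMeasurable).mul ((hu' i).aestronglyMeasurable.pow 2))
        (ae_of_all _ fun x => ?_)
      rw [abs_mul, abs_mul]
      exact mul_le_mul_of_nonneg_right
        ((abs_deriv_truncation_le hδ _).trans (le_abs_self _)) (abs_nonneg _)
    have i2 := integrable_mul_of_tsupport_subset l2 hζ.continuous hc hs
    have e : ∀ x, u' i x * (partialDeriv i ζ x * -truncation δ (u x)
        + ζ x * (-deriv (truncation δ) (u x) * u' i x))
      = -(truncation δ (u x) * u' i x * partialDeriv i ζ x)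
        - deriv (truncation δ) (u x) * u' i x ^ 2 * ζ x := fun x => by ring
    simp_rw [e]
    have i1n : Integrable (fun x => -(truncation δ (u x) * u' i x * partialDeriv i ζ x)) := i1.neg
    rw [integral_sub i1n i2, integral_neg]
    -- The sign `T_δ'(u) ≥ 0` requires `u ≥ 0`, known only almost everywhere in `U`; outside `U` the
    -- factor `ζ` vanishes.
    have : 0 ≤ ∫ x, deriv (truncation δ) (u x) * u' i x ^ 2 * ζ x := by
      refine integral_nonneg_of_ae ?_
      filter_upwards [(ae_restrict_iff' hU.measurableSet).1 hcrit.1] with x hx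
      by_cases hxU : x ∈ U
      · have := deriv_truncation_nonneg hδ (hx hxU)
        have := hζ0 x
        simp only [Pi.zero_apply]
        positivity
      · have : ζ x = 0 := image_eq_zero_of_notMem_tsupport fun h => hxU (hs h)
        simp [this]
    linarith
  have hle2 : ∫ x, (u x - 1) * (ζ x * -truncation δ (u x)) * g x
      ≤ ∫ x, |(u x - 1) * g x| * ζ x := by
    have hl := locallyIntegrableOn_top_mul hU hub hg
    have i1 := integrable_mul_of_tsupport_subset hl hζ.continuous hc hs
    have i2 : Integrable (fun x => |(u x - 1) * g x| * ζ x) :=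
      i1.abs.congr (ae_of_all _ fun x => by simp only [abs_mul, abs_of_nonneg (hζ0 x)])
    have l3 : LocallyIntegrableOn (fun x => truncation δ (u x) * ((u x - 1) * g x)) U := by
      refine locallyIntegrableOn_of_bound hU hl
        ((contDiff_truncation.continuous.comp_aestronglyMeasurable
          hu2.aestronglyMeasurable).mul hl.aestronglyMeasurable) (ae_of_all _ fun x => ?_)
      rw [abs_mul]
      exact mul_le_of_le_one_left (abs_nonneg _) (hθ1 _)
    have i3 := (integrable_mul_of_tsupport_subset l3 hζ.continuous hc hs).neg
    have e : ∀ x, (u x - 1) * (ζ x * -truncation δ (u x)) * g x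
        = -(truncation δ (u x) * ((u x - 1) * g x) * ζ x) := fun x => by ring
    simp_rw [e]
    refine integral_mono i3 i2 fun x => ?_
    simp only [← neg_mul]
    refine mul_le_mul_of_nonneg_right ((le_abs_self _).trans ?_) (hζ0 x)
    rw [abs_mul, abs_neg]
    exact mul_le_of_le_one_left (abs_nonneg _) (hθ1 _)
  have hle3 := Finset.sum_le_sum fun i (_ : i ∈ Finset.univ) => hle i
  rw [Finset.sum_neg_distrib, hsum] at hle3
  linarith

/-- The Laplacian of a critical point is bounded by `|(u - 1) g|`, in the weak sense. -/
theorem IsObstacleCriticalPoint.abs_integral_mul_coordLaplacian_le :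
    |∫ x, u x * coordLaplacian ζ x| ≤ ∫ x, |(u x - 1) * g x| * ζ x := by
  refine abs_le.2 ⟨?_, hcrit.integral_mul_coordLaplacian_le hU hu2 hu hu' hub hg hζ hc hs hζ0⟩
  have hl := hu2.locallyIntegrableOn_two
  have hLi : Integrable (coordLaplacian ζ) :=
    hζ.coordLaplacian.continuous.integrable_of_hasCompactSupport hc.coordLaplacian
  have i1 := integrable_mul_of_tsupport_subset hl hζ.coordLaplacian.continuous hc.coordLaplacian
    (tsupport_coordLaplacian_subset.trans hs)
  set A := ∫ x, |coordLaplacian ζ x|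
  -- Replacing `P_δ(u)` by `u` costs at most `2 δ ∫ |Δζ|`, which disappears as `δ → 0`.
  have key : ∀ δ : ℝ, 0 < δ → - ∫ x, u x * coordLaplacian ζ x
      ≤ (∫ x, |(u x - 1) * g x| * ζ x) + δ * (2 * A) := by
    intro δ hδ
    have h1 := hcrit.neg_integral_truncationPrimitive_le hU hu2 hu hu' hub hg hζ hc hs hζ0 hδ
    have i2 := integrable_mul_of_tsupport_subset
      (locallyIntegrableOn_comp_of_abs_deriv_le hU hl (contDiff_truncationPrimitive (δ := δ))
        (M := 1) (fun t => by
          rw [deriv_truncationPrimitive hδ]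
          exact abs_le.2 ⟨by linarith [truncation_nonneg (δ := δ) t], truncation_le_one t⟩))
      hζ.coordLaplacian.continuous hc.coordLaplacian (tsupport_coordLaplacian_subset.trans hs)
    have h2 : (∫ x, truncationPrimitive δ (u x) * coordLaplacian ζ x)
        - ∫ x, u x * coordLaplacian ζ x ≤ δ * (2 * A) := by
      have : δ * (2 * A) = ∫ x, 2 * δ * |coordLaplacian ζ x| := by
        rw [integral_const_mul]; ring
      rw [← integral_sub i2 i1, this]
      refine integral_mono (i2.sub i1) (hLi.abs.const_mul _) fun x => ?_
      simp only [← sub_mul]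
      refine (le_abs_self _).trans ?_
      rw [abs_mul]
      exact mul_le_mul_of_nonneg_right (abs_truncationPrimitive_sub_le hδ _) (abs_nonneg _)
    linarith
  have hA : 0 ≤ A := integral_nonneg fun x => abs_nonneg _
  have : - ∫ x, u x * coordLaplacian ζ x ≤ ∫ x, |(u x - 1) * g x| * ζ x := by
    refine le_of_forall_pos_le_add fun ε hε => ?_
    refine (key (ε / (2 * A + 1)) (by positivity)).trans ?_
    gcongr
    rw [div_mul_eq_mul_div, div_le_iff₀ (by positivity)]
    nlinarith
  linarith

end LaplacianBound

/-! ### Weak compactness in Hilbert spaces and in `L²` -/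

section WeakCompactness

/-- A bounded sequence in a Hilbert space has a weak cluster point. -/
theorem exists_forall_inner_eq_of_tendsto {H : Type*} [NormedAddCommGroup H]
    [InnerProductSpace ℝ H] [CompleteSpace H] {x : ℕ → H} {C : ℝ} (hx : ∀ n, ‖x n‖ ≤ C) :
    ∃ y : H, ∀ (z : H) (L : ℝ), Tendsto (fun n => inner ℝ (x n) z) atTop (𝓝 L) →
      inner ℝ y z = L := by
  let T : ℕ → WeakDual ℝ H := fun n => StrongDual.toWeakDual (InnerProductSpace.toDual ℝ H (x n))
  have hcomp := WeakDual.isCompact_closedBall (𝕜 := ℝ) (E := H) 0 C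
  have hmem : ∀ n, T n ∈ WeakDual.toStrongDual ⁻¹' Metric.closedBall (0 : StrongDual ℝ H) C := by
    intro n
    simp only [mem_preimage, Metric.mem_closedBall, dist_zero_right]
    exact ((InnerProductSpace.toDual ℝ H).norm_map (x n)).trans_le (hx n)
  -- Banach–Alaoglu along a nonprincipal ultrafilter: no subsequence or separability is needed, and
  -- a pairing that converges along `atTop` has the same limit along the ultrafilter.
  obtain ⟨φ, -, hφ⟩ := hcomp.ultrafilter_le_nhds ((hyperfilter ℕ).map T)
    (by
      rw [le_principal_iff]
      exact Filter.mem_map.2 (Filter.univ_mem' hmem))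
  refine ⟨(InnerProductSpace.toDual ℝ H).symm (WeakDual.toStrongDual φ), fun z L hL => ?_⟩
  rw [InnerProductSpace.toDual_symm_apply]
  have h1 : Tendsto T (hyperfilter ℕ) (𝓝 φ) := hφ
  have h2 : Tendsto (fun n => T n z) (hyperfilter ℕ) (𝓝 (φ z)) :=
    ((WeakDual.eval_continuous z).tendsto φ).comp h1
  have h3 : Tendsto (fun n => T n z) (hyperfilter ℕ) (𝓝 L) :=
    hL.mono_left Nat.hyperfilter_le_atTop
  exact tendsto_nhds_unique h2 h3

theorem exists_memLp_two_of_integral_sq_le {α : Type*} [MeasurableSpace α] {ν : Measure α}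
    {f : ℕ → α → ℝ} {C : ℝ} (hf : ∀ n, MemLp (f n) 2 ν) (hC : ∀ n, ∫ x, f n x ^ 2 ∂ν ≤ C) :
    ∃ G : α → ℝ, MemLp G 2 ν ∧ ∀ (ψ : α → ℝ) (L : ℝ), MemLp ψ 2 ν →
      Tendsto (fun n => ∫ x, f n x * ψ x ∂ν) atTop (𝓝 L) → ∫ x, G x * ψ x ∂ν = L := by
  have hin : ∀ {a b : α → ℝ} (ha : MemLp a 2 ν) (hb : MemLp b 2 ν),
      inner ℝ (ha.toLp a) (hb.toLp b) = ∫ x, a x * b x ∂ν := by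
    intro a b ha hb
    rw [L2.inner_def]
    refine integral_congr_ae ?_
    filter_upwards [ha.coeFn_toLp, hb.coeFn_toLp] with x h1 h2
    rw [h1, h2]
    simp [mul_comm]
  obtain ⟨y, hy⟩ := exists_forall_inner_eq_of_tendsto (x := fun n => (hf n).toLp (f n))
    (C := Real.sqrt C) (fun n => by
      refine Real.le_sqrt_of_sq_le ?_
      rw [← real_inner_self_eq_norm_sq, hin]
      simpa only [sq] using hC n)
  refine ⟨y, Lp.memLp y, fun ψ L hψ hL => ?_⟩
  have := hy (hψ.toLp ψ) L (by simpa only [hin] using hL)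
  rw [← this, ← hin (Lp.memLp y) hψ, Lp.toLp_coeFn]

end WeakCompactness

/-! ### `L²` bounds on second derivatives from the Laplacian -/

section SecondDerivatives

variable {d : ℕ} {U : Set (EuclideanSpace ℝ (Fin d))}
  {w H ψ ζ χ f : EuclideanSpace ℝ (Fin d) → ℝ}

/-- Both sides equal `-∫ ∂ⱼw ∂ⱼ∂ᵢ∂ᵢw`, after one integration by parts each and commutation of the
third derivatives. -/
theorem integral_sq_partialDeriv_partialDeriv (hw : ContDiff ℝ ∞ w) (hc : HasCompactSupport w)
    (i j : Fin d) : ∫ x, partialDeriv i (partialDeriv j w) x ^ 2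
      = ∫ x, partialDeriv j (partialDeriv j w) x * partialDeriv i (partialDeriv i w) x := by
  have h1 := integral_partialDeriv_mul (i := i) (hw.partialDeriv (i := j))
    (hw.partialDeriv (i := j)).partialDeriv (χ := partialDeriv i (partialDeriv j w))
    hc.partialDeriv
  have h2 := integral_partialDeriv_mul (i := j) (hw.partialDeriv (i := j))
    (hw.partialDeriv (i := i)).partialDeriv (χ := partialDeriv i (partialDeriv i w))
    hc.partialDeriv
  have e1 : partialDeriv i (partialDeriv j w) = partialDeriv j (partialDeriv i w) :=
    funext fun x => partialDeriv_comm hw i j x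
  have e2 : ∀ x, partialDeriv i (partialDeriv i (partialDeriv j w)) x
      = partialDeriv j (partialDeriv i (partialDeriv i w)) x := fun x => by
    rw [e1]
    exact partialDeriv_comm hw.partialDeriv i j x
  simp_rw [e2] at h1
  simp only [sq]
  rw [h1, h2]

/-- Summing the preceding identity over all pairs gives `∫ (Δw)²`, and each summand is nonnegative.
-/
theorem integral_sq_partialDeriv_partialDeriv_le (hw : ContDiff ℝ ∞ w)
    (hc : HasCompactSupport w) (i j : Fin d) :
    ∫ x, partialDeriv i (partialDeriv j w) x ^ 2 ≤ ∫ x, coordLaplacian w x ^ 2 := by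
  have hi : ∀ a b : Fin d, Integrable fun x =>
      partialDeriv b (partialDeriv b w) x * partialDeriv a (partialDeriv a w) x := fun a b =>
    ((hw.partialDeriv (i := b)).partialDeriv (i := b).continuous.mul
      (hw.partialDeriv (i := a)).partialDeriv.continuous).integrable_of_hasCompactSupport
      hc.partialDeriv.partialDeriv.mul_right
  have e : ∫ x, coordLaplacian w x ^ 2
      = ∑ a, ∑ b, ∫ x, partialDeriv a (partialDeriv b w) x ^ 2 := by
    simp_rw [integral_sq_partialDeriv_partialDeriv hw hc]
    simp_rw [← integral_finsetSum _ fun b _ => hi _ b]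
    rw [← integral_finsetSum _ fun a _ => integrable_finsetSum _ fun b _ => hi a b]
    congr 1 with x
    rw [coordLaplacian, sq, Finset.sum_mul_sum, Finset.sum_comm]
  rw [e]
  have h0 : ∀ a b, 0 ≤ ∫ x, partialDeriv a (partialDeriv b w) x ^ 2 := fun a b =>
    integral_nonneg fun x => sq_nonneg _
  exact (Finset.single_le_sum (f := fun b => ∫ x, partialDeriv i (partialDeriv b w) x ^ 2)
      (fun b _ => h0 i b) (Finset.mem_univ j)).trans
    (Finset.single_le_sum (f := fun a => ∑ b, ∫ x, partialDeriv a (partialDeriv b w) x ^ 2)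
      (fun a _ => Finset.sum_nonneg fun b _ => h0 a b) (Finset.mem_univ i))

/-- The derivatives fall on the mollifier, and the reflection signs cancel in second order. The
value at `x` is thus the weak Laplacian of `w` tested with `ρ(x - ·)`. -/
theorem coordLaplacian_mollify (hw : LocallyIntegrable w) (n : ℕ) (x) :
    coordLaplacian (mollify n w) x
      = ∫ t, w t * coordLaplacian (fun t => mollifier d n (x - t)) t := by
  have hρ := contDiff_mollifier (d := d) (n := n)
  have hρc := hasCompactSupport_mollifier (d := d) (n := n)
  have e1 : ∀ i, partialDeriv i (partialDeriv i (mollify n w)) x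
      = ∫ t, partialDeriv i (partialDeriv i (mollifier d n)) (x - t) * w t := by
    intro i
    have : partialDeriv i (mollify n w) = conv (partialDeriv i (mollifier d n)) w :=
      funext fun y => partialDeriv_conv hρ hρc hw i y
    rw [this, partialDeriv_conv hρ.partialDeriv hρc.partialDeriv hw, conv_apply]
  have e2 : ∀ i t, partialDeriv i (partialDeriv i fun t => mollifier d n (x - t)) t
      = partialDeriv i (partialDeriv i (mollifier d n)) (x - t) := by
    intro i t
    have : (partialDeriv i fun t => mollifier d n (x - t))
        = fun t => - partialDeriv i (mollifier d n) (x - t) :=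
      funext fun y => partialDeriv_comp_const_sub hρ x y
    have h3 := partialDeriv_comp_const_sub (i := i) (hρ.partialDeriv (i := i)) x t
    rw [this]
    simp only [partialDeriv] at h3 ⊢
    rw [fderiv_fun_neg, _root_.neg_apply, h3, neg_neg]
  simp only [coordLaplacian, e1, e2, Finset.mul_sum]
  rw [integral_finsetSum]
  · simp only [mul_comm]
  · intro i _
    simpa only [mul_comm] using integrable_conv_integrand
      (hρ.partialDeriv (i := i)).partialDeriv.continuous hρc.partialDeriv.partialDeriv hw x

/-- A compactly supported function whose weak Laplacian is bounded by an `L²` function has second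
weak derivatives in `L²`. -/
theorem exists_memLp_two_second_derivative (hw : Integrable w) (hwc : HasCompactSupport w)
    (hH : MemLp H 2 volume)
    (hL : ∀ ζ : EuclideanSpace ℝ (Fin d) → ℝ, ContDiff ℝ ∞ ζ → HasCompactSupport ζ →
      (∀ x, 0 ≤ ζ x) → |∫ x, w x * coordLaplacian ζ x| ≤ ∫ x, H x * ζ x) (i j : Fin d) :
    ∃ G : EuclideanSpace ℝ (Fin d) → ℝ, MemLp G 2 volume ∧
      ∀ ψ : EuclideanSpace ℝ (Fin d) → ℝ, ContDiff ℝ ∞ ψ → HasCompactSupport ψ →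
        ∫ x, G x * ψ x = ∫ x, w x * partialDeriv i (partialDeriv j ψ) x := by
  have hwl := hw.locallyIntegrable
  have hHl : LocallyIntegrable H := hH.locallyIntegrable (by norm_num)
  have hwn : ∀ n, ContDiff ℝ ∞ (mollify n w) := fun n => contDiff_mollify hwl
  have hwnc : ∀ n, HasCompactSupport (mollify n w) := fun n => hasCompactSupport_mollify hwc
  -- The hypothesis for `ζ = ρ(x - ·) ≥ 0` becomes a pointwise bound.
  have hlap : ∀ n x, |coordLaplacian (mollify n w) x| ≤ mollify n H x := by
    intro n x
    rw [coordLaplacian_mollify hwl]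
    refine (hL _ (contDiff_mollifier.comp (contDiff_const.sub contDiff_id))
      (hasCompactSupport_mollifier.comp_homeomorph (Homeomorph.subLeft x))
      fun t => mollifier_nonneg _).trans_eq ?_
    rw [mollify, conv_apply]
    exact integral_congr_ae (ae_of_all _ fun t => mul_comm _ _)
  have hbound : ∀ n, ∫ x, partialDeriv i (partialDeriv j (mollify n w)) x ^ 2
      ≤ ∫ x, H x ^ 2 := by
    intro n
    refine (integral_sq_partialDeriv_partialDeriv_le (hwn n) (hwnc n) i j).trans
      (le_trans ?_ (integral_sq_mollify_le (n := n) hHl hH.integrable_sq))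
    refine integral_mono (((hwn n).coordLaplacian.continuous.pow
      2).integrable_of_hasCompactSupport ?_) (integrable_sq_mollify hHl hH.integrable_sq)
      fun x => sq_le_sq.2 ((hlap n x).trans (le_abs_self _))
    simp only [sq]
    exact (hwnc n).coordLaplacian.mul_right
  obtain ⟨G, hG, hGlim⟩ := exists_memLp_two_of_integral_sq_le
    (fun n => (hwn n).partialDeriv.partialDeriv.continuous.memLp_of_hasCompactSupport
      (hwnc n).partialDeriv.partialDeriv) hbound
  refine ⟨G, hG, fun ψ hψ hψc => hGlim ψ _ (hψ.continuous.memLp_of_hasCompactSupport hψc) ?_⟩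
  -- Both derivatives are moved onto `ψ`, so the `L¹` convergence of `mollify n w` identifies the
  -- weak limit.
  have e : ∀ n, ∫ x, partialDeriv i (partialDeriv j (mollify n w)) x * ψ x
      = ∫ x, mollify n w x * partialDeriv i (partialDeriv j ψ) x := by
    intro n
    rw [integral_partialDeriv_mul (hwn n).partialDeriv hψ (hwnc n).partialDeriv,
      integral_partialDeriv_mul (hwn n) hψ.partialDeriv (hwnc n), neg_neg]
    simp_rw [partialDeriv_comm hψ j i]
  simp_rw [e]
  have hDc : Continuous (partialDeriv i (partialDeriv j ψ)) :=
    (hψ.partialDeriv (i := j)).partialDeriv.continuous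
  obtain ⟨B, hB⟩ :=
    (hψc.partialDeriv (i := j)).partialDeriv (i := i) |>.exists_bound_of_continuous hDc
  have hint : ∀ k, Integrable k → Integrable fun x => k x * partialDeriv i (partialDeriv j ψ) x :=
    fun k hk => hk.mul_bdd hDc.aestronglyMeasurable (ae_of_all _ hB)
  rw [tendsto_iff_dist_tendsto_zero]
  have h0 := (tendsto_integral_abs_mollify_sub hw).mul_const B
  rw [zero_mul] at h0
  refine squeeze_zero (fun _ => dist_nonneg) (fun n => ?_) h0
  rw [Real.dist_eq, ← integral_sub (hint _ (integrable_mollify hw)) (hint _ hw),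
    ← integral_mul_const]
  refine abs_integral_le_integral_abs.trans (integral_mono
    ((hint _ (integrable_mollify hw)).sub (hint _ hw)).abs
    (((integrable_mollify hw).sub hw).abs.mul_const _) fun x => ?_)
  simp only [← sub_mul, abs_mul]
  exact mul_le_mul_of_nonneg_left (hB x) (abs_nonneg _)

end SecondDerivatives

/-! ### Localization by a cutoff -/

section Localization

variable {d : ℕ} {U : Set (EuclideanSpace ℝ (Fin d))} {h u f ζ χ : EuclideanSpace ℝ (Fin d) → ℝ}
  {u' : Fin d → EuclideanSpace ℝ (Fin d) → ℝ} {p : ℝ≥0∞}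

theorem MemLpLoc.cutoff_mul (hf : MemLpLoc p U f) (hχ : Continuous χ) (hc : HasCompactSupport χ)
    (hs : tsupport χ ⊆ U) : MemLp (fun x => χ x * f x) p volume := by
  obtain ⟨B, hB⟩ := hc.exists_bound_of_continuous hχ
  have h1 : MemLp (fun x => χ x * f x) p (volume.restrict (tsupport χ)) :=
    memLp_bdd_mul (hf _ hc.isCompact hs) hχ.aestronglyMeasurable hB
  have h2 : (tsupport χ).indicator (fun x => χ x * f x) = fun x => χ x * f x := by
    rw [indicator_eq_self]
    intro x hx
    by_contra hn
    exact hx (by simp only [image_eq_zero_of_notMem_tsupport hn, zero_mul])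
  rw [← h2, memLp_indicator_iff_restrict (isClosed_tsupport χ).measurableSet]
  exact h1

theorem MeasureTheory.MemLp.memLpLoc (hf : MemLp f p (volume.restrict U)) : MemLpLoc p U f :=
  fun _ _ hKU => hf.mono_measure (Measure.restrict_mono hKU le_rfl)

theorem MemLpLoc.locallyIntegrableOn_two (hU : IsOpen U) (hf : MemLpLoc 2 U f) :
    LocallyIntegrableOn f U := by
  rw [locallyIntegrableOn_iff hU.isLocallyClosed]
  intro K hK hKc
  have : IsFiniteMeasure (volume.restrict K) := ⟨by simpa using hKc.measure_lt_top⟩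
  exact (hf K hKc hK).integrable (by norm_num)

theorem coordLaplacian_mul (hχ : ContDiff ℝ ∞ χ) (hζ : ContDiff ℝ ∞ ζ) (x) :
    coordLaplacian (fun y => χ y * ζ y) x = coordLaplacian χ x * ζ x
      + 2 * (∑ i, partialDeriv i χ x * partialDeriv i ζ x) + χ x * coordLaplacian ζ x := by
  have e : ∀ i, partialDeriv i (partialDeriv i fun y => χ y * ζ y) x
      = partialDeriv i (partialDeriv i χ) x * ζ x
        + 2 * (partialDeriv i χ x * partialDeriv i ζ x)
        + χ x * partialDeriv i (partialDeriv i ζ) x := by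
    intro i
    have h1 : (partialDeriv i fun y => χ y * ζ y)
        = fun y => partialDeriv i χ y * ζ y + χ y * partialDeriv i ζ y :=
      funext fun y => partialDeriv_mul hχ hζ y
    have d1 : DifferentiableAt ℝ (fun y => partialDeriv i χ y * ζ y) x :=
      ((hχ.partialDeriv (i := i)).mul hζ).differentiable (by simp) x
    have d2 : DifferentiableAt ℝ (fun y => χ y * partialDeriv i ζ y) x :=
      (hχ.mul (hζ.partialDeriv (i := i))).differentiable (by simp) x
    have h2 : partialDeriv i (fun y => partialDeriv i χ y * ζ y + χ y * partialDeriv i ζ y) x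
        = partialDeriv i (fun y => partialDeriv i χ y * ζ y) x
          + partialDeriv i (fun y => χ y * partialDeriv i ζ y) x := by
      simp only [partialDeriv] at d1 d2 ⊢
      rw [fderiv_fun_add d1 d2]
      rfl
    rw [h1, h2, partialDeriv_mul hχ.partialDeriv hζ, partialDeriv_mul hχ hζ.partialDeriv]
    ring
  simp only [coordLaplacian, e, Finset.sum_add_distrib, Finset.sum_mul, Finset.mul_sum]

/-- The bound is tested with `χ ζ`. In `Δ(χ ζ)` the cross term `2 ∇χ · ∇ζ` is integrated by parts
against `u`, which gives `∫ χ u Δζ = ∫ u Δ(χ ζ) + ∫ (u Δχ + 2 ∇χ · ∇u) ζ`. No derivative of `ζ` is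
left in the remainder, and `ζ` need not be supported in `U`. -/
theorem abs_integral_cutoff_mul_coordLaplacian_le (hu : ∀ i, HasWeakPartial U i u (u' i))
    (hul : LocallyIntegrableOn u U) (hh : LocallyIntegrableOn h U)
    (hL : ∀ ζ : EuclideanSpace ℝ (Fin d) → ℝ, ContDiff ℝ ∞ ζ → HasCompactSupport ζ →
      tsupport ζ ⊆ U → (∀ x, 0 ≤ ζ x) →
      |∫ x, u x * coordLaplacian ζ x| ≤ ∫ x, |h x| * ζ x)
    (hχ : ContDiff ℝ ∞ χ) (hχc : HasCompactSupport χ) (hχU : tsupport χ ⊆ U) (hχ0 : ∀ x, 0 ≤ χ x)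
    (hζ : ContDiff ℝ ∞ ζ) (hζc : HasCompactSupport ζ) (hζ0 : ∀ x, 0 ≤ ζ x) :
    |∫ x, χ x * u x * coordLaplacian ζ x| ≤ ∫ x, (χ x * |h x| + |coordLaplacian χ x * u x
      + 2 * ∑ i, partialDeriv i χ x * u' i x|) * ζ x := by
  have hI : ∀ k ξ η : EuclideanSpace ℝ (Fin d) → ℝ, LocallyIntegrableOn k U → Continuous ξ →
      tsupport ξ ⊆ tsupport χ → Continuous η → Integrable (fun x => ξ x * k x * η x) := by
    intro k ξ η hk hξ hξs hη
    have hξc : HasCompactSupport ξ := hχc.isCompact.of_isClosed_subset (isClosed_tsupport _) hξs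
    refine (integrable_mul_of_tsupport_subset hk (hξ.mul hη) hξc.mul_right
      ((tsupport_mul_subset_left (f := ξ) (g := η)).trans (hξs.trans hχU))).congr
      (ae_of_all _ fun x => ?_)
    simp only [Pi.mul_apply]
    ring
  have hdχ : ∀ i, ContDiff ℝ ∞ (partialDeriv i χ) := fun i => hχ.partialDeriv
  have hds : ∀ i, tsupport (partialDeriv i χ) ⊆ tsupport χ := fun i => tsupport_partialDeriv_subset
  have j1 := hI u _ ζ hul hχ.coordLaplacian.continuous tsupport_coordLaplacian_subset
    hζ.continuous
  have j2 : ∀ i, Integrable fun x => partialDeriv i χ x * u x * partialDeriv i ζ x := fun i =>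
    hI u _ _ hul (hdχ i).continuous (hds i) hζ.partialDeriv.continuous
  have j3 : ∀ i, Integrable fun x => partialDeriv i χ x * u' i x * ζ x := fun i =>
    hI _ _ _ (hu i).2.1 (hdχ i).continuous (hds i) hζ.continuous
  have j4 : Integrable fun x => χ x * u x * coordLaplacian ζ x :=
    hI u _ _ hul hχ.continuous subset_rfl hζ.coordLaplacian.continuous
  have j5 : Integrable fun x => χ x * h x * ζ x :=
    hI h _ _ hh hχ.continuous subset_rfl hζ.continuous
  have j6 : ∀ i, Integrable fun x => partialDeriv i (partialDeriv i χ) x * u x * ζ x := fun i =>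
    hI u _ _ hul (hdχ i).partialDeriv.continuous
      (tsupport_partialDeriv_subset.trans (hds i)) hζ.continuous
  have j2s : Integrable fun x => ∑ i, partialDeriv i χ x * u x * partialDeriv i ζ x :=
    integrable_finsetSum _ fun i _ => j2 i
  have j3s : Integrable fun x => ∑ i, partialDeriv i χ x * u' i x * ζ x :=
    integrable_finsetSum _ fun i _ => j3 i
  have e1 : ∫ x, u x * coordLaplacian (fun y => χ y * ζ y) x
      = (∫ x, coordLaplacian χ x * u x * ζ x)
        + 2 * (∑ i, ∫ x, partialDeriv i χ x * u x * partialDeriv i ζ x)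
        + ∫ x, χ x * u x * coordLaplacian ζ x := by
    have j12 : Integrable fun x => coordLaplacian χ x * u x * ζ x
        + 2 * ∑ i, partialDeriv i χ x * u x * partialDeriv i ζ x := j1.add (j2s.const_mul 2)
    rw [← integral_finsetSum _ fun i _ => j2 i, ← integral_const_mul,
      ← integral_add j1 (j2s.const_mul 2), ← integral_add j12 j4]
    congr 1 with x
    have : ∑ i, partialDeriv i χ x * u x * partialDeriv i ζ x
        = u x * ∑ i, partialDeriv i χ x * partialDeriv i ζ x := by
      rw [Finset.mul_sum]
      exact Finset.sum_congr rfl fun i _ => by ring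
    rw [coordLaplacian_mul hχ hζ, this]
    ring
  have e2 : ∑ i, ∫ x, partialDeriv i χ x * u x * partialDeriv i ζ x
      = - ((∫ x, coordLaplacian χ x * u x * ζ x)
        + ∑ i, ∫ x, partialDeriv i χ x * u' i x * ζ x) := by
    have e3 : ∀ i, ∫ x, partialDeriv i χ x * u x * partialDeriv i ζ x
        = - ((∫ x, partialDeriv i (partialDeriv i χ) x * u x * ζ x)
          + ∫ x, partialDeriv i χ x * u' i x * ζ x) := by
      intro i
      rw [(hu i).integral_mul_eq (hdχ i) hζ
        (hζc.isCompact.inter_left (isClosed_tsupport _))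
        (inter_subset_left.trans ((hds i).trans hχU)), ← integral_add (j6 i) (j3 i)]
      simp only [add_mul]
    have e4 : ∫ x, coordLaplacian χ x * u x * ζ x
        = ∑ i, ∫ x, partialDeriv i (partialDeriv i χ) x * u x * ζ x := by
      rw [← integral_finsetSum _ fun i _ => j6 i]
      simp only [coordLaplacian, Finset.sum_mul]
    simp_rw [e3]
    rw [Finset.sum_neg_distrib, Finset.sum_add_distrib, e4]
  have jR : Integrable fun x => (coordLaplacian χ x * u x
      + 2 * ∑ i, partialDeriv i χ x * u' i x) * ζ x := by
    refine (j1.add (j3s.const_mul 2)).congr (ae_of_all _ fun x => ?_)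
    simp only [Pi.add_apply, ← Finset.sum_mul]
    ring
  have e5 : ∫ x, (coordLaplacian χ x * u x + 2 * ∑ i, partialDeriv i χ x * u' i x) * ζ x
      = (∫ x, coordLaplacian χ x * u x * ζ x)
        + 2 * ∑ i, ∫ x, partialDeriv i χ x * u' i x * ζ x := by
    rw [← integral_finsetSum _ fun i _ => j3 i, ← integral_const_mul,
      ← integral_add j1 (j3s.const_mul 2)]
    congr 1 with x
    simp only [← Finset.sum_mul]
    ring
  have e6 : ∫ x, χ x * u x * coordLaplacian ζ x
      = (∫ x, u x * coordLaplacian (fun y => χ y * ζ y) x)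
        + ∫ x, (coordLaplacian χ x * u x + 2 * ∑ i, partialDeriv i χ x * u' i x) * ζ x := by
    rw [e1, e2, e5]
    ring
  have k1 := hL _ (hχ.mul hζ) hχc.mul_right
    ((tsupport_mul_subset_left (f := χ) (g := ζ)).trans hχU)
    fun x => mul_nonneg (hχ0 x) (hζ0 x)
  have j5a : Integrable fun x => χ x * |h x| * ζ x :=
    j5.abs.congr (ae_of_all _ fun x => by
      simp only [abs_mul, abs_of_nonneg (hζ0 x), abs_of_nonneg (hχ0 x)])
  have jRa : Integrable fun x => |coordLaplacian χ x * u x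
      + 2 * ∑ i, partialDeriv i χ x * u' i x| * ζ x :=
    jR.abs.congr (ae_of_all _ fun x => by simp only [abs_mul, abs_of_nonneg (hζ0 x)])
  rw [e6]
  refine (abs_add_le _ _).trans ?_
  simp only [add_mul _ |_| _]
  rw [integral_add j5a jRa]
  refine add_le_add (k1.trans_eq ?_) (abs_integral_le_integral_abs.trans_eq ?_)
  · congr 1 with x
    change _ * (χ x * ζ x) = _
    ring
  · simp only [abs_mul _ (ζ _), abs_of_nonneg (hζ0 _)]

end Localization

/-! ### Gluing weak derivatives along an exhaustion -/

section Gluing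

variable {d : ℕ} {U : Set (EuclideanSpace ℝ (Fin d))} {f : EuclideanSpace ℝ (Fin d) → ℝ}
  {j : Fin d}

open Classical in
theorem exists_hasWeakPartial_memLpLoc_two (hU : IsOpen U) (hf : LocallyIntegrableOn f U)
    {V : ℕ → Set (EuclideanSpace ℝ (Fin d))} (hV : ∀ n, IsOpen (V n)) (hmono : Monotone V)
    (hVU : ⋃ n, V n = U)
    (hG : ∀ n, ∃ G, MemLp G 2 (volume.restrict (V n)) ∧ HasWeakPartial (V n) j f G) :
    ∃ G, HasWeakPartial U j f G ∧ MemLpLoc 2 U G := by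
  choose G hG2 hGw using hG
  -- At each point the derivative from the first set containing it is used. By uniqueness it agrees
  -- a.e. on `V N` with `G N`, and every compact subset of `U` lies in a single `V N`.
  let g : EuclideanSpace ℝ (Fin d) → ℝ := fun x =>
    if h : ∃ n, x ∈ V n then G (Nat.find h) x else 0
  have hae : ∀ N, ∀ᵐ x ∂volume.restrict (V N), G N x = g x := by
    intro N
    have h1 : ∀ᵐ x ∂volume.restrict (V N), ∀ m, m ≤ N → x ∈ V m → G m x = G N x := by
      refine ae_all_iff.2 fun m => ?_
      by_cases hm : m ≤ N
      · have h2 := (hGw m).ae_eq (hV m) ((hGw N).mono (hmono hm))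
        filter_upwards [ae_restrict_of_ae ((ae_restrict_iff' (hV m).measurableSet).1 h2)]
          with x hx _
        exact hx
      · exact ae_of_all _ fun x h => absurd h hm
    filter_upwards [h1, ae_restrict_mem (hV N).measurableSet] with x hx hxN
    have hex : ∃ n, x ∈ V n := ⟨N, hxN⟩
    change _ = if h : ∃ n, x ∈ V n then G (Nat.find h) x else 0
    rw [dif_pos hex, hx _ (Nat.find_min' hex hxN) (Nat.find_spec hex)]
  have hcov : ∀ K, IsCompact K → K ⊆ U → ∃ N, K ⊆ V N := by
    intro K hK hKU
    exact hK.elim_directed_cover V hV (hKU.trans hVU.ge) hmono.directed_le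
  have hloc : MemLpLoc 2 U g := by
    intro K hK hKU
    obtain ⟨N, hN⟩ := hcov K hK hKU
    exact ((hG2 N).mono_measure (Measure.restrict_mono hN le_rfl)).ae_eq
      (ae_restrict_of_ae_restrict_of_subset hN (hae N))
  refine ⟨g, .of_integral_eq hf (hloc.locallyIntegrableOn_two hU) fun ψ hψ hc hs => ?_, hloc⟩
  obtain ⟨N, hN⟩ := hcov _ hc.isCompact hs
  rw [(hGw N).integral_eq hψ hc hN]
  congr 1
  refine integral_congr_ae ?_
  filter_upwards [(ae_restrict_iff' (hV N).measurableSet).1 (hae N)] with x hx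
  by_cases hxψ : x ∈ tsupport ψ
  · rw [hx (hN hxψ)]
  · rw [image_eq_zero_of_notMem_tsupport hxψ, mul_zero, mul_zero]

end Gluing

/-! ### Interior regularity and the conclusion -/

section InteriorRegularity

variable {d : ℕ} {U K : Set (EuclideanSpace ℝ (Fin d))} {h u : EuclideanSpace ℝ (Fin d) → ℝ}
  {u' : Fin d → EuclideanSpace ℝ (Fin d) → ℝ}

/-- The second derivative of `χ u` serves as the derivative of `u' i`: for `ψ` supported in the
interior of `K`, where `χ = 1`, `∫ u' i ∂ⱼψ = -∫ u ∂ᵢ∂ⱼψ = -∫ G ψ`. -/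
theorem exists_second_weakPartial_of_coordLaplacian_bound (hU : IsOpen U)
    (hu2 : MemLp u 2 (volume.restrict U))
    (hu : ∀ i, HasWeakPartial U i u (u' i)) (hu' : ∀ i, MemLp (u' i) 2 (volume.restrict U))
    (hh : MemLpLoc 2 U h)
    (hL : ∀ ζ : EuclideanSpace ℝ (Fin d) → ℝ, ContDiff ℝ ∞ ζ → HasCompactSupport ζ →
      tsupport ζ ⊆ U → (∀ x, 0 ≤ ζ x) →
      |∫ x, u x * coordLaplacian ζ x| ≤ ∫ x, |h x| * ζ x)
    (hK : IsCompact K) (hKU : K ⊆ U) (i j : Fin d) :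
    ∃ G, MemLp G 2 volume ∧ HasWeakPartial (interior K) j (u' i) G := by
  have hul := hu2.locallyIntegrableOn_two
  obtain ⟨χ, hχ, hχc, hχU, hχ01, hχ1, -⟩ := exists_smooth_cutoff hU hK hKU
  have hH : MemLp (fun x => χ x * |h x| + |coordLaplacian χ x * u x
      + 2 * ∑ i, partialDeriv i χ x * u' i x|) 2 volume := by
    have h1 : MemLp (fun x => χ x * |h x|) 2 volume :=
      MemLpLoc.cutoff_mul (fun K hK hKU => (hh K hK hKU).norm) hχ.continuous hχc hχU
    have h2 : MemLp (fun x => coordLaplacian χ x * u x) 2 volume :=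
      hu2.memLpLoc.cutoff_mul hχ.coordLaplacian.continuous hχc.coordLaplacian
        (tsupport_coordLaplacian_subset.trans hχU)
    have h3 : MemLp (fun x => ∑ i, partialDeriv i χ x * u' i x) 2 volume :=
      memLp_finsetSum _ fun k _ => (hu' k).memLpLoc.cutoff_mul
        (hχ.partialDeriv (i := k)).continuous hχc.partialDeriv
        (tsupport_partialDeriv_subset.trans hχU)
    exact h1.add (h2.add (h3.const_mul 2)).norm
  obtain ⟨G, hG, hGw⟩ := exists_memLp_two_second_derivative
    (integrable_cutoff_mul hul hχ.continuous hχc hχU) hχc.mul_right hH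
    (fun ζ hζ hζc hζ0 => abs_integral_cutoff_mul_coordLaplacian_le hu hul
      (hh.locallyIntegrableOn_two hU) hL hχ hχc hχU (fun x => (hχ01 x).1) hζ hζc hζ0) i j
  refine ⟨G, hG, .of_integral_eq ((hu i).2.1.mono_set (interior_subset.trans hKU))
    ((hG.locallyIntegrable (by norm_num)).locallyIntegrableOn _) fun ψ hψ hψc hψs => ?_⟩
  have hψK := hψs.trans interior_subset
  have e := (hu i).integral_eq (hψ.partialDeriv (i := j)) hψc.partialDeriv
    (tsupport_partialDeriv_subset.trans (hψK.trans hKU))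
  rw [hGw ψ hψ hψc]
  have e2 : ∫ x, χ x * u x * partialDeriv i (partialDeriv j ψ) x
      = ∫ x, u x * partialDeriv i (partialDeriv j ψ) x := by
    congr 1 with x
    by_cases hx : x ∈ tsupport ψ
    · rw [hχ1 x (hψK hx), one_mul]
    · rw [partialDeriv_eq_zero_of_notMem fun h => hx (tsupport_partialDeriv_subset h), mul_zero,
        mul_zero]
  rw [e2]
  linarith

end InteriorRegularity

theorem iUnion_ball_one_sub :
    ⋃ n : ℕ, Metric.ball (0 : EuclideanSpace ℝ (Fin 2)) (1 - 1 / ((n : ℝ) + 1))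
      = Metric.ball 0 1 := by
  refine subset_antisymm (iUnion_subset fun n => Metric.ball_subset_ball ?_) fun x hx => ?_
  · have : 0 ≤ 1 / ((n : ℝ) + 1) := by positivity
    linarith
  · rw [mem_ball_zero_iff] at hx
    obtain ⟨n, hn⟩ := exists_nat_one_div_lt (sub_pos.2 hx)
    refine mem_iUnion.2 ⟨n, ?_⟩
    rw [mem_ball_zero_iff]
    linarith

theorem proposition6p2
    (g μ : EuclideanSpace ℝ (Fin 2) → ℝ)
    (hg : ∀ q : ℝ≥0∞, 1 ≤ q → q < 2 → MemSobolevLoc 1 q (Metric.ball 0 1) g)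
    (hμ : MemSobolev 1 2 (Metric.ball 0 1) μ)
    (hμ_bdd : MemLpLoc ∞ (Metric.ball 0 1) μ)
    (hμ_crit : IsObstacleCriticalPoint (Metric.ball 0 1) g μ) :
    MemSobolevLoc 2 2 (Metric.ball 0 1) μ := by
  have hU : IsOpen (Metric.ball (0 : EuclideanSpace ℝ (Fin 2)) 1) := Metric.isOpen_ball
  obtain ⟨hμ2, hμw⟩ := hμ
  choose μ' hμ' hμ'2 using hμw
  -- The exponent 1 is enough: the planar embedding raises `W^{1,1}_loc` to `L²_loc`.
  obtain ⟨-, hgw⟩ := hg 1 le_rfl (by norm_num)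
  choose g' hg' _ using hgw
  have hg2 : MemLpLoc 2 (Metric.ball 0 1) g := memLpLoc_two_of_hasWeakPartial hU hg'
  have hh : MemLpLoc 2 (Metric.ball 0 1) (fun x => (μ x - 1) * g x) := fun K hK hKU =>
    (hg2 K hK hKU).mul ((hμ_bdd K hK hKU).sub (memLp_top_const 1))
  refine ⟨hμ2.memLpLoc, fun i => ⟨μ' i, hμ' i, (hμ'2 i : MemLp _ _ _).memLpLoc, fun j => ?_⟩⟩
  -- Exhaustion by concentric balls; for `n = 0` the radius is 0 and the ball is empty, which is
  -- harmless.
  refine exists_hasWeakPartial_memLpLoc_two hU (hμ' i).2.1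
    (V := fun n : ℕ => Metric.ball 0 (1 - 1 / ((n : ℝ) + 1))) (fun n => Metric.isOpen_ball)
    (fun m n hmn => Metric.ball_subset_ball ?_) iUnion_ball_one_sub fun n => ?_
  · have : 1 / ((n : ℝ) + 1) ≤ 1 / ((m : ℝ) + 1) := Nat.one_div_le_one_div hmn
    linarith
  · obtain ⟨G, hG, hGw⟩ := exists_second_weakPartial_of_coordLaplacian_bound hU hμ2 hμ' hμ'2 hh
      (fun ζ hζ hζc hζs hζ0 => hμ_crit.abs_integral_mul_coordLaplacian_le hU hμ2 hμ' hμ'2 hμ_bdd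
        (hg' 0).1 hζ hζc hζs hζ0)
      (isCompact_closedBall (0 : EuclideanSpace ℝ (Fin 2)) (1 - 1 / ((n : ℝ) + 1)))
      (Metric.closedBall_subset_ball (by
        have : 0 < 1 / ((n : ℝ) + 1) := by positivity
        linarith)) i j
    exact ⟨G, hG.restrict _, hGw.mono Metric.ball_subset_interior_closedBall⟩
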